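/- Let $k$ be a field, $H$ a finite-dimensional Hopf algebra over $k$ with comultiplication $h\mapsto\sum h_1\otimes h_2$ and counit $\varepsilon$, $R$ a $k$-algebra with unit, and let $A=R\#_\sigma H$ be a crossed product. That is, $H$ acts weakly on $R$ ($1\cdot a=a$, $h\cdot 1=\varepsilon(h)1$, $h\cdot(ab)=\sum(h_1\cdot a)(h_2\cdot b)$), and $\sigma\in\mathrm{Hom}_k(H\otimes H,R)$ is convolution-invertible and satisfies, for all $h,l,m\in H$ and $a\in R$: $\sigma(1,h)=\sigma(h,1)=\varepsilon(h)1$, $\;h\cdot(l\cdot a)=\sum\sigma(h_1,l_1)(h_2l_2\cdot a)\sigma^{-1}(h_3,l_3)$ and $\sum(h_1\cdot\sigma(l_1,m_1))\,\sigma(h_2,l_2m_2)=\sum\sigma(h_1,l_1)\,\sigma(h_2l_2,m)$. The algebra $A$ is $R\otimes H$ with product $(a\#h)(b\#l)=\sum a(h_1\cdot b)\sigma(h_2,l_1)\#h_3l_2$, and $R$ is identified with $R\#1$. Let $r_j$ denote the Jacobson radical. Put $$r_{jH}(R):=(r_j(R):H)=\{x\in R\mid h\cdot x\in r_j(R)\text{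 for all }h\in H\},\qquad r_{Hj}(R):=r_j(R\#_\sigma H)\cap R .$$ For a module algebra $B$ over a Hopf algebra $L$, $B\#L$ denotes the smash product (the crossed product with trivial cocycle) and $r_{Lj}(B):=r_j(B\#L)\cap B$. For a subspace $I\subseteq R$, $I\#_\sigma H$ denotes the span of the elements $a\#h$ with $a\in I$, $h\in H$; similarly for smash products. The dual Hopf algebra $H^*$ acts on $A$ by $f\cdot(a\#h)=\sum a\#h_1f(h_2)$, and $H$ acts on $A\#H^*$ by $h\cdot(x\#f)=x\#(h\rightharpoonup f)$ with $(h\rightharpoonup f)(l)=f(lh)$. Then: 1. $r_{jH}(R)\#_\sigma H=r_{H^*j}(R\#_\sigma H)$; 2. $r_{Hj}(R)=r_{jH}(R)$; 3. $r_{Hj}(A\#H^*)=(r_{Hj}(R)\#_\sigma H)\#H^*$. -/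

import Mathlib

namespace HopfCrossed
noncomputable section

open TensorProduct Coalgebra WithConv

set_option linter.unusedSectionVars false

/-! ### The dual Hopf algebra `H*`

For a coalgebra `C`, the convolution algebra structure on `WithConv (C →ₗ[k] A)` is Mathlib's:
`(f * g)(c) = ∑ f(c₁) g(c₂)`, with unit `c ↦ ε(c) 1`. -/

/-- The linear dual `C* = Hom_k(C, k)` of a coalgebra, with its convolution product. -/
def HDual (k C : Type*) [Field k] [AddCommGroup C] [Module k C] : Type _ :=
  WithConv (C →ₗ[k] k)

section Dual
variable (k : Type*) [Field k]

instance dualRing (C : Type*) [AddCommGroup C] [Module k C] [Coalgebra k C] : Ring (HDual k C) :=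
  inferInstanceAs (Ring (WithConv (C →ₗ[k] k)))

instance dualAlgebra (C : Type*) [AddCommGroup C] [Module k C] [Coalgebra k C] :
    Algebra k (HDual k C) :=
  inferInstanceAs (Algebra k (WithConv (C →ₗ[k] k)))

/-- An element of the dual as a linear form. -/
def HDual.equiv (C : Type*) [AddCommGroup C] [Module k C] [Coalgebra k C] :
    HDual k C ≃ₗ[k] (C →ₗ[k] k) where
  toFun f := WithConv.ofConv f
  invFun f := WithConv.toConv f
  map_add' _ _ := rfl
  map_smul' _ _ := rfl

instance (C : Type*) [AddCommGroup C] [Module k C] [Coalgebra k C] : FunLike (HDual k C) C k where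
  coe f := HDual.equiv k C f
  coe_injective _ _ h := (HDual.equiv k C).injective (DFunLike.coe_injective h)

instance (C : Type*) [AddCommGroup C] [Module k C] [Coalgebra k C] :
    LinearMapClass (HDual k C) k C k where
  map_add f := map_add (HDual.equiv k C f)
  map_smulₛₗ f := map_smul (HDual.equiv k C f)

section
variable {k} {C : Type*} [AddCommGroup C] [Module k C] [Coalgebra k C]
@[simp] theorem dual_zero_apply (x : C) : (0 : HDual k C) x = 0 := rfl
@[simp] theorem dual_add_apply (f g : HDual k C) (x : C) : (f + g) x = f x + g x := rfl
@[simp] theorem dual_smul_apply (c : k) (f : HDual k C) (x : C) : (c • f) x = c * f x := rfl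
@[simp] theorem dual_one_apply (x : C) : (1 : HDual k C) x = counit x := rfl
@[simp] theorem dual_equiv_apply (f : HDual k C) (x : C) : HDual.equiv k C f x = f x := rfl
@[simp] theorem dual_equiv_symm_apply (f : C →ₗ[k] k) (x : C) :
    (HDual.equiv k C).symm f x = f x := rfl
theorem dual_mul_apply (f g : HDual k C) (x : C) :
    (f * g) x = LinearMap.mul' k k (TensorProduct.map (HDual.equiv k C f) (HDual.equiv k C g)
      (comul x)) := rfl
theorem dual_ext {f g : HDual k C} (h : HDual.equiv k C f = HDual.equiv k C g) : f = g :=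
  (HDual.equiv k C).injective h
end

/-- The isomorphism `M* ⊗ N* ≃ (M ⊗ N)*` in finite dimension, `(f ⊗ g)(x ⊗ y) = f(x) g(y)`. -/
def dualPair (M N : Type*) [AddCommGroup M] [Module k M] [Coalgebra k M] [FiniteDimensional k M]
    [AddCommGroup N] [Module k N] [Coalgebra k N] [FiniteDimensional k N] :
    (HDual k M ⊗[k] HDual k N) ≃ₗ[k] HDual k (M ⊗[k] N) :=
  (TensorProduct.congr (HDual.equiv k M) (HDual.equiv k N)).trans
    ((TensorProduct.dualDistribEquiv k M N).trans (HDual.equiv k (M ⊗[k] N)).symm)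

theorem dualPair_tmul_tmul {M N : Type*} [AddCommGroup M] [Module k M] [Coalgebra k M]
    [FiniteDimensional k M]
    [AddCommGroup N] [Module k N] [Coalgebra k N] [FiniteDimensional k N]
    (f : HDual k M) (g : HDual k N) (x : M) (y : N) :
    dualPair k M N (f ⊗ₜ g) (x ⊗ₜ y) = f x * g y := by
  simp [dualPair, TensorProduct.dualDistribEquiv, TensorProduct.dualDistribEquivOfBasis]

variable (H : Type*) [Ring H] [Bialgebra k H] [FiniteDimensional k H]

/-- The coalgebra structure on `H*`: `Δ(f)` is the element of `H* ⊗ H*` which corresponds to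
`x ⊗ y ↦ f(x y)`, and `ε(f) = f(1)`. -/
instance dualCoalgebraStruct : CoalgebraStruct k (HDual k H) where
  comul := (dualPair k H H).symm.toLinearMap ∘ₗ
    (HDual.equiv k (H ⊗[k] H)).symm.toLinearMap ∘ₗ
    (LinearMap.mul' k H).lcomp k k ∘ₗ (HDual.equiv k H).toLinearMap
  counit := (LinearMap.applyₗ (1 : H)) ∘ₗ (HDual.equiv k H).toLinearMap

variable {k H}

theorem dualPair_comul (f : HDual k H) :
    dualPair k H H (comul f) = (HDual.equiv k (H ⊗[k] H)).symm (HDual.equiv k H f ∘ₗ LinearMap.mul' k H) := by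
  simp [comul]; rfl

theorem dualPair_comul_apply (f : HDual k H) (x y : H) :
    dualPair k H H (comul f) (x ⊗ₜ y) = f (x * y) := by
  rw [dualPair_comul]; simp

theorem dual_counit_apply (f : HDual k H) : counit (R := k) f = f 1 := rfl

theorem dualPair_lTensor_comul (t : HDual k H ⊗[k] HDual k H) :
    dualPair k H (H ⊗[k] H) ((dualPair k H H).toLinearMap.lTensor (HDual k H)
      ((comul (R := k) (A := HDual k H)).lTensor (HDual k H) t)) =
    (HDual.equiv k _).symm (HDual.equiv k _ (dualPair k H H t) ∘ₗ (LinearMap.mul' k H).lTensor H) := by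
  induction t with
  | zero => simp
  | add x y hx hy => simp [map_add, hx, hy, LinearMap.add_comp]
  | tmul f g =>
    apply dual_ext; ext x y z
    simp [dualPair_tmul_tmul, dualPair_comul_apply]

theorem dualPair_assoc (s : HDual k H ⊗[k] HDual k H) (g : HDual k H) (x y z : H) :
    dualPair k H (H ⊗[k] H) ((dualPair k H H).toLinearMap.lTensor (HDual k H)
      (TensorProduct.assoc k _ _ _ (s ⊗ₜ g))) (x ⊗ₜ (y ⊗ₜ z)) =
    dualPair k H H s (x ⊗ₜ y) * g z := by
  induction s with
  | zero => simp
  | add x y hx hy => simp [map_add, hx, hy, TensorProduct.add_tmul, add_mul]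
  | tmul f g => simp [dualPair_tmul_tmul, mul_assoc]

theorem dualPair_rTensor_comul (t : HDual k H ⊗[k] HDual k H) (x y z : H) :
    dualPair k H (H ⊗[k] H) ((dualPair k H H).toLinearMap.lTensor (HDual k H)
      (TensorProduct.assoc k _ _ _ ((comul (R := k) (A := HDual k H)).rTensor (HDual k H) t)))
      (x ⊗ₜ (y ⊗ₜ z)) =
    dualPair k H H t ((x * y) ⊗ₜ z) := by
  induction t with
  | zero => simp
  | add x y hx hy => simp [map_add, hx, hy]
  | tmul f g => 
    rw [LinearMap.rTensor_tmul, dualPair_assoc, dualPair_comul_apply, dualPair_tmul_tmul]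

instance dualCoalgebra : Coalgebra k (HDual k H) where
  coassoc := by
    ext f
    apply ((LinearEquiv.lTensor (HDual k H) (dualPair k H H)).trans 
      (dualPair k H (H ⊗[k] H))).injective
    apply dual_ext; ext x y z
    refine (dualPair_rTensor_comul (comul f) x y z).trans ?_
    refine Eq.trans ?_ (congrArg (fun φ : HDual k (H ⊗[k] (H ⊗[k] H)) => φ (x ⊗ₜ (y ⊗ₜ z)))
      (dualPair_lTensor_comul (comul f))).symm
    simp [dualPair_comul_apply, mul_assoc]
  rTensor_counit_comp_comul := by
    have key (t : HDual k H ⊗[k] HDual k H) : ∀ x, (TensorProduct.lid k _ 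
        ((counit (R := k) (A := HDual k H)).rTensor (HDual k H) t)) x = dualPair k H H t (1 ⊗ₜ x) := by
      intro x
      induction t with
      | zero => simp
      | add x y hx hy => simp [map_add, hx, hy]
      | tmul f g => simp [dualPair_tmul_tmul, dual_counit_apply]
    ext f
    apply (TensorProduct.lid k _).injective
    apply dual_ext; ext x
    refine (key _ x).trans ?_
    simp [dualPair_comul_apply]
  lTensor_counit_comp_comul := by
    have key (t : HDual k H ⊗[k] HDual k H) : ∀ x, (TensorProduct.rid k _ 
        ((counit (R := k) (A := HDual k H)).lTensor (HDual k H) t)) x = dualPair k H H t (x ⊗ₜ 1) := by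
      intro x
      induction t with
      | zero => simp
      | add x y hx hy => simp [map_add, hx, hy]
      | tmul f g => simp [dualPair_tmul_tmul, dual_counit_apply, mul_comm]
    ext f
    apply (TensorProduct.rid k _).injective
    apply dual_ext; ext x
    refine (key _ x).trans ?_
    simp [dualPair_comul_apply]

theorem dualPair_mul (s t : HDual k H ⊗[k] HDual k H) :
    dualPair k H H (s * t) = dualPair k H H s * dualPair k H H t := by
  have h1 (f g : HDual k H) : dualPair k H H (f ⊗ₜ g) =
      (HDual.equiv k _).symm ((Algebra.TensorProduct.lmul' k (S := k)).toLinearMap ∘ₗ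
        (TensorProduct.map (HDual.equiv k H f) (HDual.equiv k H g))) := by
    apply dual_ext; ext x y
    simp [dualPair_tmul_tmul]
  induction s with
  | zero => simp
  | add x y hx hy => simp [add_mul, hx, hy]
  | tmul f g =>
    induction t with
    | zero => simp
    | add x y hx hy => simp [mul_add, hx, hy]
    | tmul f' g' =>
      rw [Algebra.TensorProduct.tmul_mul_tmul, h1, h1, h1]
      have := congrArg toConv (LinearMap.algHom_comp_convMul_distrib
        (Algebra.TensorProduct.lmul' k (S := k))
        (toConv (TensorProduct.map (HDual.equiv k H f) (HDual.equiv k H g)))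
        (toConv (TensorProduct.map (HDual.equiv k H f') (HDual.equiv k H g'))))
      have h2 := TensorProduct.map_convMul_map (f := toConv (HDual.equiv k H f))
        (g := toConv (HDual.equiv k H g)) (h := toConv (HDual.equiv k H f'))
        (k := toConv (HDual.equiv k H g'))
      erw [h2] at this
      exact this

theorem dual_mul_one (f g : HDual k H) : (f * g) 1 = f 1 * g 1 := by
  rw [dual_mul_apply, Bialgebra.comul_one, Algebra.TensorProduct.one_def]
  simp

theorem dual_mul_comp_mul (f g : HDual k H) :
    (HDual.equiv k (H ⊗[k] H)).symm (HDual.equiv k H (f * g) ∘ₗ LinearMap.mul' k H) =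
    (HDual.equiv k (H ⊗[k] H)).symm (HDual.equiv k H f ∘ₗ LinearMap.mul' k H) *
    (HDual.equiv k (H ⊗[k] H)).symm (HDual.equiv k H g ∘ₗ LinearMap.mul' k H) := by
  apply dual_ext
  exact LinearMap.convMul_comp_coalgHom_distrib (toConv (HDual.equiv k H f))
    (toConv (HDual.equiv k H g)) (Bialgebra.mulCoalgHom k H)

theorem dual_comul_mul (f g : HDual k H) :
    comul (R := k) (f * g) = comul (R := k) f * comul (R := k) g := by
  apply (dualPair k H H).injective
  rw [dualPair_mul, dualPair_comul, dualPair_comul, dualPair_comul]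
  exact dual_mul_comp_mul f g

theorem dual_comul_one : comul (R := k) (1 : HDual k H) = 1 := by
  apply (dualPair k H H).injective
  apply dual_ext; ext x y
  simp [dualPair_comul_apply, Algebra.TensorProduct.one_def, dualPair_tmul_tmul]

/-- The dual `H*` of a finite-dimensional bialgebra is a bialgebra. (If `H` is a Hopf algebra, so
is `H*`; its antipode plays no role in the formation of smash products.) -/
instance dualBialgebra : Bialgebra k (HDual k H) :=
  Bialgebra.mk' k (HDual k H) (by simp [dual_counit_apply]) (fun {f g} => dual_mul_one f g)
    dual_comul_one (fun {f g} => dual_comul_mul f g)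

end Dual

/-! ### Crossed products -/

/-- The data of a crossed product `R #_σ H`: a weak action of `H` on `R` and a
convolution-invertible two-cocycle `σ : H ⊗ H → R` for which `R` is a twisted `H`-module. All
products of maps below are convolution products. -/
structure CrossedSystem (k H R : Type*) [Field k] [Ring H] [Bialgebra k H] [Ring R]
    [Algebra k R] where
  /-- the weak action, `act h a = h · a` -/
  act : H →ₗ[k] R →ₗ[k] R
  /-- `1 · a = a` -/
  one_act : ∀ a : R, act 1 a = a
  /-- `h · 1 = ε(h) 1` -/
  act_one : ∀ h : H, act h 1 = algebraMap k R (counit h)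
  /-- `h · (a b) = ∑ (h₁ · a) (h₂ · b)` -/
  act_mul : ∀ a b : R, toConv (act.flip (a * b)) = toConv (act.flip a) * toConv (act.flip b)
  /-- the cocycle `σ`, a convolution-invertible element of `Hom_k(H ⊗ H, R)` -/
  σ : (WithConv (H ⊗[k] H →ₗ[k] R))ˣ
  /-- `σ(1, h) = ε(h) 1` -/
  σ_one_left : ∀ h : H, σ.val (1 ⊗ₜ h) = algebraMap k R (counit h)
  /-- `σ(h, 1) = ε(h) 1` -/
  σ_one_right : ∀ h : H, σ.val (h ⊗ₜ 1) = algebraMap k R (counit h)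
  /-- `h · (l · a) = ∑ σ(h₁, l₁) (h₂ l₂ · a) σ⁻¹(h₃, l₃)` -/
  twisted : ∀ a : R,
    toConv (TensorProduct.lift act ∘ₗ (act.flip a).lTensor H) =
      σ.val * toConv (act.flip a ∘ₗ LinearMap.mul' k H) * σ⁻¹.val
  /-- `∑ (h₁ · σ(l₁, m₁)) σ(h₂, l₂ m₂) = ∑ σ(h₁, l₁) σ(h₂ l₂, m)` -/
  cocycle :
    toConv (TensorProduct.lift act ∘ₗ σ.val.ofConv.lTensor H) *
        toConv (σ.val.ofConv ∘ₗ (LinearMap.mul' k H).lTensor H) =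
      toConv ((TensorProduct.rid k R).toLinearMap ∘ₗ TensorProduct.map σ.val.ofConv counit ∘ₗ
          (TensorProduct.assoc k H H H).symm.toLinearMap) *
        toConv (σ.val.ofConv ∘ₗ (LinearMap.mul' k H).rTensor H ∘ₗ
          (TensorProduct.assoc k H H H).symm.toLinearMap)

section conv
variable {k : Type*} [Field k]
variable {E M T : Type*} [AddCommGroup E] [Module k E] [Coalgebra k E]
  [AddCommGroup M] [Module k M] [Coalgebra k M] [Ring T] [Algebra k T]

theorem conv_apply (f g : WithConv (E →ₗ[k] T)) (e : E) :
    (f * g).ofConv e = ∑ i ∈ (ℛ k e).index, f.ofConv ((ℛ k e).left i) * g.ofConv ((ℛ k e).right i) :=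
  Coalgebra.Repr.convMul_apply (ℛ k e) f g

theorem conv_tmul_apply (f g : WithConv (E ⊗[k] M →ₗ[k] T)) (e : E) (m : M) :
    (f * g).ofConv (e ⊗ₜ m) = ∑ i ∈ (ℛ k e).index, ∑ j ∈ (ℛ k m).index,
      f.ofConv ((ℛ k e).left i ⊗ₜ (ℛ k m).left j) *
        g.ofConv ((ℛ k e).right i ⊗ₜ (ℛ k m).right j) := by
  rw [LinearMap.convMul_apply, TensorProduct.comul_tmul, ← (ℛ k e).eq, ← (ℛ k m).eq]
  simp [TensorProduct.sum_tmul, TensorProduct.tmul_sum]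
  exact Finset.sum_comm

theorem conv_left_apply (f : E →ₗ[k] T) (F : E ⊗[k] M →ₗ[k] T) (e : E) (m : M) :
    (toConv (f ∘ₗ (TensorProduct.rid k E).toLinearMap ∘ₗ counit.lTensor E) * toConv F).ofConv
        (e ⊗ₜ m) =
      ∑ i ∈ (ℛ k e).index, f ((ℛ k e).left i) * F ((ℛ k e).right i ⊗ₜ m) := by
  rw [conv_tmul_apply]
  refine Finset.sum_congr rfl fun i _ => ?_
  conv_rhs => rw [← sum_counit_smul (ℛ k m)]
  simp [TensorProduct.tmul_sum, Finset.mul_sum]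

theorem conv_comp {D : Type*} [AddCommGroup D] [Module k D] [Coalgebra k D]
    (f g : WithConv (M →ₗ[k] T)) (h : D →ₗc[k] M) :
    toConv ((f * g).ofConv ∘ₗ h.toLinearMap) =
      toConv (f.ofConv ∘ₗ h.toLinearMap) * toConv (g.ofConv ∘ₗ h.toLinearMap) :=
  congrArg toConv (LinearMap.convMul_comp_coalgHom_distrib f g h)

variable {R H : Type*} [Ring R] [Algebra k R] [Ring H] [Bialgebra k H]

/-- `x ↦ p(x) ⊗ 1` -/
def inclL (p : M →ₗ[k] R) : WithConv (M →ₗ[k] R ⊗[k] H) :=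
  toConv ((Algebra.TensorProduct.includeLeft : R →ₐ[k] R ⊗[k] H).toLinearMap ∘ₗ p)

/-- `x ↦ 1 ⊗ p(x)` -/
def inclR (p : M →ₗ[k] H) : WithConv (M →ₗ[k] R ⊗[k] H) :=
  toConv ((Algebra.TensorProduct.includeRight : H →ₐ[k] R ⊗[k] H).toLinearMap ∘ₗ p)

theorem inclL_mul (p q : WithConv (M →ₗ[k] R)) :
    (inclL (p * q).ofConv : WithConv (M →ₗ[k] R ⊗[k] H)) = inclL p.ofConv * inclL q.ofConv :=
  congrArg toConv (LinearMap.algHom_comp_convMul_distrib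
    (Algebra.TensorProduct.includeLeft : R →ₐ[k] R ⊗[k] H) p q)

theorem toConv_map_comul (p : M →ₗ[k] R) (g : M →ₗ[k] H) :
    toConv (TensorProduct.map p g ∘ₗ comul) = inclL p * inclR g := by
  ext x
  rw [Coalgebra.Repr.convMul_apply (ℛ k x)]
  simp only [inclL, inclR, LinearMap.comp_apply]
  rw [← (ℛ k x).eq]
  simp 
end conv

namespace CrossedSystem
variable {k H R : Type*} [Field k] [Ring H] [Bialgebra k H] [Ring R] [Algebra k R]
variable (S : CrossedSystem k H R)

/-- `h ⊗ l ↦ ε(l) (h · b)` -/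
def actFst (b : R) : H ⊗[k] H →ₗ[k] R :=
  S.act.flip b ∘ₗ (TensorProduct.rid k H).toLinearMap ∘ₗ counit.lTensor H

/-- `h ⊗ l ↦ ∑ a (h₁ · b) σ(h₂, l₁) ⊗ h₃ l₂` -/
def mulAux (a b : R) : H ⊗[k] H →ₗ[k] R ⊗[k] H :=
  TensorProduct.map (LinearMap.mul k R a ∘ₗ (toConv (S.actFst b) * S.σ.val).ofConv)
    (LinearMap.mul' k H) ∘ₗ comul

theorem actFst_add (b b' : R) : S.actFst (b + b') = S.actFst b + S.actFst b' := by
  simp [actFst, LinearMap.add_comp]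

theorem actFst_smul (c : k) (b : R) : S.actFst (c • b) = c • S.actFst b := by
  simp [actFst, LinearMap.smul_comp]

/-- The bilinear product on `R ⊗ H`,
`(a ⊗ h) (b ⊗ l) = ∑ a (h₁ · b) σ(h₂, l₁) ⊗ h₃ l₂`. -/
def mulLin : (R ⊗[k] H) →ₗ[k] (R ⊗[k] H) →ₗ[k] (R ⊗[k] H) :=
  TensorProduct.curry (TensorProduct.lift (TensorProduct.lift
    (LinearMap.mk₂ k S.mulAux
      (fun a a' b => by
        rw [mulAux, map_add, LinearMap.add_comp, TensorProduct.map_add_left,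
          LinearMap.add_comp]; rfl)
      (fun c a b => by
        rw [mulAux, map_smul, LinearMap.smul_comp, TensorProduct.map_smul_left,
          LinearMap.smul_comp]; rfl)
      (fun a b b' => by
        rw [mulAux, actFst_add, toConv_add, add_mul, ofConv_add, LinearMap.comp_add,
          TensorProduct.map_add_left, LinearMap.add_comp]; rfl)
      (fun c a b => by
        rw [mulAux, actFst_smul, toConv_smul, smul_mul_assoc, ofConv_smul, LinearMap.comp_smul,
          TensorProduct.map_smul_left, LinearMap.smul_comp]; rfl))) ∘ₗ
    (TensorProduct.tensorTensorTensorComm k R H R H).toLinearMap)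

theorem mulLin_tmul (a b : R) (h g : H) :
    S.mulLin (a ⊗ₜ h) (b ⊗ₜ g) = S.mulAux a b (h ⊗ₜ g) := by
  simp [mulLin]

theorem map_mul_left {D : Type*} [AddCommGroup D] [Module k D] (a : R) (p : D →ₗ[k] R)
    (g : D →ₗ[k] H) (t : D ⊗[k] D) :
    TensorProduct.map (LinearMap.mul k R a ∘ₗ p) g t = (a ⊗ₜ 1) * TensorProduct.map p g t := by
  induction t with
  | zero => simp
  | add x y hx hy => simp [mul_add, hx, hy]
  | tmul b g => simp

theorem mulAux_left (a b : R) (x : H ⊗[k] H) :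
    S.mulAux a b x = (a ⊗ₜ 1) * S.mulAux 1 b x := by
  simp only [mulAux, LinearMap.comp_apply, map_mul_left]
  rw [← mul_assoc]; simp

theorem mulLin_left (a : R) (h : H) (y : R ⊗[k] H) :
    S.mulLin (a ⊗ₜ h) y = (a ⊗ₜ 1) * S.mulLin (1 ⊗ₜ h) y := by
  induction y with
  | zero => simp
  | add x y hx hy => simp [mul_add, hx, hy]
  | tmul b g => rw [mulLin_tmul, mulLin_tmul, mulAux_left]

theorem mulAux_one (b : R) :
    toConv (S.mulAux 1 b) =
      inclL (S.actFst b) * (inclL S.σ.val.ofConv * inclR (LinearMap.mul' k H)) := by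
  have : (LinearMap.mul k R 1 : R →ₗ[k] R) = LinearMap.id := by ext; simp
  rw [mulAux, toConv_map_comul, this, LinearMap.id_comp, inclL_mul, mul_assoc]

/-- `h ⊗ l ↦ ∑ σ(h₁, l₁) ⊗ h₂ l₂` -/
def W : WithConv (H ⊗[k] H →ₗ[k] R ⊗[k] H) := inclL S.σ.val.ofConv * inclR (LinearMap.mul' k H)

theorem mulLin_one (h : H) (b : R) (g : H) :
    S.mulLin (1 ⊗ₜ h) (b ⊗ₜ g) = ∑ i ∈ (ℛ k h).index,
      (S.act ((ℛ k h).left i) b ⊗ₜ 1) * S.W.ofConv ((ℛ k h).right i ⊗ₜ g) := by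
  rw [mulLin_tmul]
  have h1 := congrArg (fun f : WithConv (H ⊗[k] H →ₗ[k] R ⊗[k] H) => f.ofConv (h ⊗ₜ g))
    (S.mulAux_one b)
  have h2 := conv_left_apply ((Algebra.TensorProduct.includeLeft : R →ₐ[k] R ⊗[k] H).toLinearMap ∘ₗ
    S.act.flip b) S.W.ofConv h g
  exact h1.trans h2

theorem incl_conv_apply {D : Type*} [AddCommGroup D] [Module k D] [Coalgebra k D]
    (p : D →ₗ[k] R) (g : D →ₗ[k] H) (d : D) :
    (inclL p * inclR g).ofConv d =
      ∑ i ∈ (ℛ k d).index, p ((ℛ k d).left i) ⊗ₜ g ((ℛ k d).right i) := by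
  rw [conv_apply]
  simp [inclL, inclR]

/-- left multiplication by `1 # h` on a convolution -/
theorem lemmaA {D : Type*} [AddCommGroup D] [Module k D] [Coalgebra k D]
    (p : D →ₗ[k] R) (g : D →ₗ[k] H) (h : H) (d : D) :
    S.mulLin (1 ⊗ₜ h) ((inclL p * inclR g).ofConv d) =
      (inclL (TensorProduct.lift S.act ∘ₗ p.lTensor H) *
        toConv (S.W.ofConv ∘ₗ g.lTensor H)).ofConv (h ⊗ₜ d) := by
  rw [conv_tmul_apply, incl_conv_apply, Finset.sum_comm, map_sum]
  refine Finset.sum_congr rfl fun i _ => ?_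
  rw [mulLin_one]
  simp [inclL]

/-- right multiplication by `c # m` on a convolution -/
theorem lemmaB {D : Type*} [AddCommGroup D] [Module k D] [Coalgebra k D]
    (p : D →ₗ[k] R) (g : D →ₗ[k] H) (c : R) (d : D) (m : H) :
    S.mulLin ((inclL p * inclR g).ofConv d) (c ⊗ₜ m) =
      (inclL (p ∘ₗ (TensorProduct.rid k D).toLinearMap ∘ₗ counit.lTensor D) *
        toConv (S.mulAux 1 c ∘ₗ g.rTensor H)).ofConv (d ⊗ₜ m) := by
  refine Eq.trans ?_ (conv_left_apply
    ((Algebra.TensorProduct.includeLeft : R →ₐ[k] R ⊗[k] H).toLinearMap ∘ₗ p) _ d m).symm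
  rw [incl_conv_apply]
  simp only [map_sum, LinearMap.sum_apply]
  refine Finset.sum_congr rfl fun i _ => ?_
  rw [mulLin_tmul, mulAux_left]
  simp

theorem act_mul_apply (h : H) (a b : R) :
    S.act h (a * b) = ∑ i ∈ (ℛ k h).index,
      S.act ((ℛ k h).left i) a * S.act ((ℛ k h).right i) b := by
  have := congrArg (fun f : WithConv (H →ₗ[k] R) => f.ofConv h) (S.act_mul a b)
  refine this.trans ?_
  rw [conv_apply]
  rfl

theorem act_conv {D : Type*} [AddCommGroup D] [Module k D] [Coalgebra k D]
    (p q : WithConv (D →ₗ[k] R)) :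
    toConv (TensorProduct.lift S.act ∘ₗ (p * q).ofConv.lTensor H) =
      toConv (TensorProduct.lift S.act ∘ₗ p.ofConv.lTensor H) *
        toConv (TensorProduct.lift S.act ∘ₗ q.ofConv.lTensor H) := by
  apply WithConv.ofConv_injective
  refine TensorProduct.ext' fun h d => ?_
  rw [conv_tmul_apply, Finset.sum_comm]
  change S.act h ((p * q).ofConv d) = _
  rw [conv_apply, map_sum]
  refine Finset.sum_congr rfl fun i _ => ?_
  rw [act_mul_apply]
  rfl

theorem inclL_comp {D M : Type*} [AddCommGroup D] [Module k D] [AddCommGroup M] [Module k M]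
    (p : M →ₗ[k] R) (f : D →ₗ[k] M) :
    (toConv ((inclL p : WithConv (M →ₗ[k] R ⊗[k] H)).ofConv ∘ₗ f)) = inclL (p ∘ₗ f) := rfl

theorem inclR_comp {D M : Type*} [AddCommGroup D] [Module k D] [AddCommGroup M] [Module k M]
    (p : M →ₗ[k] H) (f : D →ₗ[k] M) :
    (toConv ((inclR p : WithConv (M →ₗ[k] R ⊗[k] H)).ofConv ∘ₗ f)) = inclR (p ∘ₗ f) := rfl

theorem inclL_mul' {M : Type*} [AddCommGroup M] [Module k M] [Coalgebra k M]
    (p q : M →ₗ[k] R) :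
    (inclL p * inclL q : WithConv (M →ₗ[k] R ⊗[k] H)) = inclL (toConv p * toConv q).ofConv :=
  (inclL_mul (toConv p) (toConv q)).symm

/-- `h ⊗ (l ⊗ m) ↦ ε(m) h ⊗ l` -/
def prTwo : H ⊗[k] (H ⊗[k] H) →ₗc[k] H ⊗[k] H :=
  Coalgebra.TensorProduct.map (CoalgHom.id k H)
    ((Coalgebra.TensorProduct.rid k k H).toCoalgHom.comp
      (Coalgebra.TensorProduct.map (CoalgHom.id k H) (counitCoalgHom k H)))

/-- `(h ⊗ l) ⊗ m ↦ ε(m) h ⊗ l` -/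
def prTwo' : (H ⊗[k] H) ⊗[k] H →ₗc[k] H ⊗[k] H :=
  (Coalgebra.TensorProduct.rid k k (H ⊗[k] H)).toCoalgHom.comp
      (Coalgebra.TensorProduct.map (CoalgHom.id k (H ⊗[k] H)) (counitCoalgHom k H))

/-- `h ⊗ (l ⊗ m) ↦ h ⊗ l m` -/
def mulL : H ⊗[k] (H ⊗[k] H) →ₗc[k] H ⊗[k] H :=
  Coalgebra.TensorProduct.map (CoalgHom.id k H) (Bialgebra.mulCoalgHom k H)

/-- `(h ⊗ l) ⊗ m ↦ h l ⊗ m` -/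
def mulR : (H ⊗[k] H) ⊗[k] H →ₗc[k] H ⊗[k] H :=
  Coalgebra.TensorProduct.map (Bialgebra.mulCoalgHom k H) (CoalgHom.id k H)

/-- `h ⊗ (l ⊗ m) ↦ (h ⊗ l) ⊗ m` -/
def assoc' : H ⊗[k] (H ⊗[k] H) →ₗc[k] (H ⊗[k] H) ⊗[k] H :=
  (Coalgebra.TensorProduct.assoc k k H H H).symm.toCoalgHom

theorem prTwo_eq : (prTwo (k := k) (H := H)).toLinearMap =
    ((TensorProduct.rid k H).toLinearMap ∘ₗ counit.lTensor H).lTensor H := by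
  ext x y z; simp [prTwo]

theorem prTwo'_eq : (prTwo' (k := k) (H := H)).toLinearMap =
    ((TensorProduct.rid k (H ⊗[k] H)).toLinearMap ∘ₗ counit.lTensor (H ⊗[k] H)) := by
  ext x y z; simp [prTwo']

theorem mulL_eq : (mulL (k := k) (H := H)).toLinearMap = (LinearMap.mul' k H).lTensor H := by
  ext x y z; simp [mulL]

theorem mulR_eq : (mulR (k := k) (H := H)).toLinearMap = (LinearMap.mul' k H).rTensor H := by
  ext x y z; simp [mulR]

theorem assoc'_eq : (assoc' (k := k) (H := H)).toLinearMap =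
    (TensorProduct.assoc k H H H).symm.toLinearMap := by
  ext x y z; simp [assoc']

theorem twisted' (c : R) :
    toConv (TensorProduct.lift S.act ∘ₗ (S.act.flip c).lTensor H) * S.σ.val =
      S.σ.val * toConv (S.act.flip c ∘ₗ LinearMap.mul' k H) := by
  rw [S.twisted, mul_assoc, Units.inv_mul, mul_one]

/-- the value of a triple product, as a convolution -/
def triple (b c : R) : WithConv (H ⊗[k] (H ⊗[k] H) →ₗ[k] R ⊗[k] H) :=
  inclL (toConv (TensorProduct.lift S.act ∘ₗ (counit.smulRight b).lTensor H) *
    (toConv (S.σ.val.ofConv ∘ₗ prTwo.toLinearMap) *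
    (toConv ((S.act.flip c ∘ₗ LinearMap.mul' k H) ∘ₗ prTwo.toLinearMap) *
    toConv (S.σ.val.ofConv ∘ₗ (LinearMap.mul' k H).rTensor H ∘ₗ
          (TensorProduct.assoc k H H H).symm.toLinearMap)))).ofConv *
  inclR (LinearMap.mul' k H ∘ₗ (LinearMap.mul' k H).lTensor H)

theorem assoc_left (b c : R) (h l m : H) :
    S.mulLin (1 ⊗ₜ h) (S.mulLin (b ⊗ₜ l) (c ⊗ₜ m)) = (S.triple b c).ofConv (h ⊗ₜ (l ⊗ₜ m)) := by
  have hp : LinearMap.mul k R b ∘ₗ (toConv (S.actFst c) * S.σ.val).ofConv =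
      (toConv (counit.smulRight b) * (toConv (S.actFst c) * S.σ.val)).ofConv := by
    generalize toConv (S.actFst c) * S.σ.val = q
    refine LinearMap.ext fun d => ?_
    rw [conv_apply]
    conv_lhs => rw [← sum_counit_smul (ℛ k d)]
    simp
  have hW : toConv (S.W.ofConv ∘ₗ (LinearMap.mul' k H).lTensor H) =
      inclL (S.σ.val.ofConv ∘ₗ (LinearMap.mul' k H).lTensor H) *
        inclR (LinearMap.mul' k H ∘ₗ (LinearMap.mul' k H).lTensor H) := by
    rw [← mulL_eq, W, conv_comp, inclL_comp, inclR_comp]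
  have hA : toConv (TensorProduct.lift S.act ∘ₗ (S.actFst c).lTensor H) =
      toConv ((TensorProduct.lift S.act ∘ₗ (S.act.flip c).lTensor H) ∘ₗ prTwo.toLinearMap) := by
    congr 1; ext x y z; simp [prTwo, actFst]
  have hG : toConv ((TensorProduct.rid k R).toLinearMap ∘ₗ TensorProduct.map S.σ.val.ofConv counit ∘ₗ
          (TensorProduct.assoc k H H H).symm.toLinearMap) =
      toConv (S.σ.val.ofConv ∘ₗ prTwo.toLinearMap) := by
    congr 1; ext x y z; simp [prTwo]
  have hT := congrArg (fun f => toConv (f.ofConv ∘ₗ (prTwo (k := k) (H := H)).toLinearMap))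
    (S.twisted' c)
  simp only [conv_comp] at hT
  have hC := S.cocycle
  rw [hG] at hC
  have hP : TensorProduct.lift S.act ∘ₗ
      (toConv (counit.smulRight b) * (toConv (S.actFst c) * S.σ.val)).ofConv.lTensor H =
      (toConv (TensorProduct.lift S.act ∘ₗ (counit.smulRight b).lTensor H) *
        (toConv (TensorProduct.lift S.act ∘ₗ (S.actFst c).lTensor H) *
          toConv (TensorProduct.lift S.act ∘ₗ S.σ.val.ofConv.lTensor H))).ofConv := by
    apply WithConv.toConv_injective
    rw [act_conv, act_conv]
  rw [mulLin_tmul, mulAux, ← ofConv_toConv (TensorProduct.map _ _ ∘ₗ _), toConv_map_comul, lemmaA,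
    hW, hp, hP, ← mul_assoc, inclL_mul', toConv_ofConv, mul_assoc, mul_assoc, hC,
    hA, ← mul_assoc (toConv ((TensorProduct.lift S.act ∘ₗ (S.act.flip c).lTensor H) ∘ₗ _)), hT,
    mul_assoc]
  rfl

theorem assoc_right (b c : R) (h l m : H) :
    S.mulLin (S.mulLin (1 ⊗ₜ h) (b ⊗ₜ l)) (c ⊗ₜ m) = (S.triple b c).ofConv (h ⊗ₜ (l ⊗ₜ m)) := by
  have h1 : (LinearMap.mul k R 1 : R →ₗ[k] R) = LinearMap.id := by ext; simp
  have hM : toConv (S.mulAux 1 c ∘ₗ (LinearMap.mul' k H).rTensor H) =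
      inclL (S.actFst c ∘ₗ (LinearMap.mul' k H).rTensor H) *
      (inclL (S.σ.val.ofConv ∘ₗ (LinearMap.mul' k H).rTensor H) *
        inclR (LinearMap.mul' k H ∘ₗ (LinearMap.mul' k H).rTensor H)) := by
    rw [← ofConv_toConv (S.mulAux 1 c), mulAux_one, ← mulR_eq, conv_comp, conv_comp,
      inclL_comp, inclL_comp, inclR_comp]
  rw [mulLin_tmul, mulAux, ← ofConv_toConv (TensorProduct.map _ _ ∘ₗ _), toConv_map_comul, lemmaB,
    hM, h1, LinearMap.id_comp, ← prTwo'_eq]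
  have hr := conv_comp (toConv (S.actFst b)) S.σ.val prTwo'
  rw [← ofConv_toConv (_ ∘ₗ prTwo'.toLinearMap), hr, inclL_mul]
  have key (F : WithConv ((H ⊗[k] H) ⊗[k] H →ₗ[k] R ⊗[k] H)) : F.ofConv ((h ⊗ₜ l) ⊗ₜ m) =
    (toConv (F.ofConv ∘ₗ assoc'.toLinearMap)).ofConv (h ⊗ₜ (l ⊗ₜ m)) := by simp [assoc']
  rw [key]
  refine congrArg (fun f : WithConv (H ⊗[k] (H ⊗[k] H) →ₗ[k] R ⊗[k] H) =>
    f.ofConv (h ⊗ₜ (l ⊗ₜ m))) (?_ : _ = S.triple b c)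
  simp only [conv_comp, inclL_comp, inclR_comp]
  simp only [mul_assoc, triple, inclL_mul]
  congr 1
  · congr 1; ext x y z; simp [assoc', prTwo', actFst, mul_smul]
  congr 1
  · congr 1; ext x y z; simp [assoc', prTwo', prTwo]
  congr 1
  · congr 1; ext x y z; simp [assoc', prTwo, actFst]
  congr 1
  congr 1; ext x y z; simp [assoc', mul_assoc]

theorem mulLin_assoc (x y z : R ⊗[k] H) :
    S.mulLin (S.mulLin x y) z = S.mulLin x (S.mulLin y z) := by
  induction x with
  | zero => simp
  | add x x' hx hx' => simp [hx, hx']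
  | tmul a h =>
  have h1 (t w : R ⊗[k] H) : S.mulLin ((a ⊗ₜ 1) * t) w = (a ⊗ₜ 1) * S.mulLin t w := by
    induction t with
    | zero => simp
    | add x x' hx hx' => simp [hx, hx', mul_add]
    | tmul b l => rw [mulLin_left, Algebra.TensorProduct.tmul_mul_tmul, one_mul, mulLin_left S (a * b),
        ← mul_assoc, Algebra.TensorProduct.tmul_mul_tmul, one_mul]
  rw [mulLin_left S a h y, mulLin_left S a h, h1]
  congr 1
  induction y with
  | zero => simp
  | add x x' hx hx' => simp [hx, hx']
  | tmul b l =>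
  induction z with
  | zero => simp
  | add x x' hx hx' => simp [hx, hx']
  | tmul c m => rw [assoc_left, assoc_right]

theorem conv_one_tmul {T : Type*} [Ring T] [Algebra k T] (f g : WithConv (H ⊗[k] H →ₗ[k] T))
    (m : H) : (f * g).ofConv (1 ⊗ₜ m) = ∑ j ∈ (ℛ k m).index,
      f.ofConv (1 ⊗ₜ (ℛ k m).left j) * g.ofConv (1 ⊗ₜ (ℛ k m).right j) := by
  rw [LinearMap.convMul_apply, TensorProduct.comul_tmul, ← (ℛ k m).eq, Bialgebra.comul_one,
    Algebra.TensorProduct.one_def]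
  simp [TensorProduct.tmul_sum]

theorem conv_tmul_one {T : Type*} [Ring T] [Algebra k T] (f g : WithConv (H ⊗[k] H →ₗ[k] T))
    (m : H) : (f * g).ofConv (m ⊗ₜ 1) = ∑ j ∈ (ℛ k m).index,
      f.ofConv ((ℛ k m).left j ⊗ₜ 1) * g.ofConv ((ℛ k m).right j ⊗ₜ 1) := by
  rw [LinearMap.convMul_apply, TensorProduct.comul_tmul, ← (ℛ k m).eq, Bialgebra.comul_one,
    Algebra.TensorProduct.one_def]
  simp [TensorProduct.sum_tmul]

theorem W_one_left (m : H) : S.W.ofConv (1 ⊗ₜ m) = 1 ⊗ₜ m := by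
  rw [W, conv_one_tmul]
  conv_rhs => rw [← sum_counit_smul (ℛ k m)]
  simp [inclL, inclR, S.σ_one_left, TensorProduct.tmul_sum, Algebra.algebraMap_eq_smul_one,
    TensorProduct.smul_tmul]

theorem W_one_right (m : H) : S.W.ofConv (m ⊗ₜ 1) = 1 ⊗ₜ m := by
  rw [W, conv_tmul_one]
  conv_rhs => rw [← sum_counit_smul (ℛ k m)]
  simp [inclL, inclR, S.σ_one_right, TensorProduct.tmul_sum, Algebra.algebraMap_eq_smul_one,
    TensorProduct.smul_tmul]

theorem one_mulLin (x : R ⊗[k] H) : S.mulLin (1 ⊗ₜ 1) x = x := by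
  induction x with
  | zero => simp
  | add x x' hx hx' => simp [hx, hx']
  | tmul b l =>
    rw [mulLin_tmul]
    have h1 := congrArg (fun f : WithConv (H ⊗[k] H →ₗ[k] R ⊗[k] H) => f.ofConv (1 ⊗ₜ l))
      (S.mulAux_one b)
    refine h1.trans ?_
    change (inclL (S.actFst b) * S.W).ofConv (1 ⊗ₜ l) = _
    rw [conv_one_tmul]
    conv_rhs => rw [← sum_counit_smul (ℛ k l)]
    simp [inclL, W_one_left, actFst, S.one_act, TensorProduct.tmul_sum,
      TensorProduct.smul_tmul]

theorem mulLin_one' (x : R ⊗[k] H) : S.mulLin x (1 ⊗ₜ 1) = x := by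
  induction x with
  | zero => simp
  | add x x' hx hx' => simp [hx, hx']
  | tmul b l =>
    rw [mulLin_left, mulLin_one]
    have : (b ⊗ₜ[k] l) = (b ⊗ₜ[k] (1 : H)) * (1 ⊗ₜ[k] l) := by simp
    rw [this]
    congr 1
    conv_rhs => rw [← sum_counit_smul (ℛ k l)]
    simp [W_one_right, S.act_one, TensorProduct.tmul_sum, Algebra.algebraMap_eq_smul_one,
      TensorProduct.smul_tmul]

theorem mulLin_map (f g : H →ₗ[k] H)
    (hf : comul ∘ₗ f = f.lTensor H ∘ₗ comul) (hg : comul ∘ₗ g = g.lTensor H ∘ₗ comul)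
    (a b : R) (h l : H) :
    S.mulLin (a ⊗ₜ f h) (b ⊗ₜ g l) =
      ∑ i ∈ (ℛ k h).index, ∑ j ∈ (ℛ k l).index,
        (a * (toConv (S.actFst b) * S.σ.val).ofConv ((ℛ k h).left i ⊗ₜ (ℛ k l).left j)) ⊗ₜ
          (f ((ℛ k h).right i) * g ((ℛ k l).right j)) := by
  have hf' : comul (R := k) (f h) = f.lTensor H (comul h) := LinearMap.congr_fun hf h
  have hg' : comul (R := k) (g l) = g.lTensor H (comul l) := LinearMap.congr_fun hg l
  rw [mulLin_tmul, mulAux, LinearMap.comp_apply, TensorProduct.comul_tmul, hf', hg',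
    ← (ℛ k h).eq, ← (ℛ k l).eq, Finset.sum_comm]
  simp only [map_sum, LinearMap.lTensor_tmul, TensorProduct.sum_tmul, TensorProduct.tmul_sum,
    TensorProduct.AlgebraTensorModule.tensorTensorTensorComm_tmul, TensorProduct.map_tmul,
    LinearMap.comp_apply, LinearMap.mul'_apply, LinearMap.mul_apply_apply]

end CrossedSystem

/-- The crossed product `R #_σ H`: the space `R ⊗ H` with the product
`(a # h) (b # l) = ∑ a (h₁ · b) σ(h₂, l₁) # h₃ l₂`. -/
def CrossedProduct {k H R : Type*} [Field k] [Ring H] [Bialgebra k H] [Ring R] [Algebra k R]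
    (_S : CrossedSystem k H R) : Type _ := R ⊗[k] H

namespace CrossedProduct
variable {k H R : Type*} [Field k] [Ring H] [Bialgebra k H] [Ring R] [Algebra k R]
variable (S : CrossedSystem k H R)

instance : AddCommGroup (CrossedProduct S) := inferInstanceAs (AddCommGroup (R ⊗[k] H))
instance : Module k (CrossedProduct S) := inferInstanceAs (Module k (R ⊗[k] H))

/-- The identity map from `R ⊗ H` to `R #_σ H`. -/
def equiv : R ⊗[k] H ≃ₗ[k] CrossedProduct S := LinearEquiv.refl k (R ⊗[k] H)

instance : Ring (CrossedProduct S) where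
  __ := (inferInstance : AddCommGroup (CrossedProduct S))
  mul x y := equiv S (S.mulLin ((equiv S).symm x) ((equiv S).symm y))
  one := equiv S (1 ⊗ₜ 1)
  mul_assoc x y z := S.mulLin_assoc x y z
  one_mul x := S.one_mulLin x
  mul_one x := S.mulLin_one' x
  left_distrib x y z := map_add (S.mulLin x) y z
  right_distrib x y z := S.mulLin.map_add₂ x y z
  zero_mul x := S.mulLin.map_zero₂ x
  mul_zero x := map_zero (S.mulLin x)

instance : Algebra k (CrossedProduct S) :=
  Algebra.ofModule (fun r x y => S.mulLin.map_smul₂ r x y) (fun r x y => map_smul (S.mulLin x) r y)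

/-- The element `a # h`. -/
def mk (a : R) (h : H) : CrossedProduct S := equiv S (a ⊗ₜ h)

theorem mk_mul_mk (a b : R) (h l : H) :
    mk S a h * mk S b l =
      ∑ i ∈ (ℛ k h).index, ∑ j ∈ (ℛ k l).index,
        mk S (a * ∑ n ∈ (ℛ k ((ℛ k h).left i)).index,
          S.act ((ℛ k ((ℛ k h).left i)).left n) b *
            S.σ.val ((ℛ k ((ℛ k h).left i)).right n ⊗ₜ (ℛ k l).left j))
          ((ℛ k h).right i * (ℛ k l).right j) := by
  have h1 := S.mulLin_map LinearMap.id LinearMap.id (by simp) (by simp) a b h l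
  refine h1.trans (Finset.sum_congr rfl fun i _ => Finset.sum_congr rfl fun j _ => ?_)
  have h2 := conv_left_apply (S.act.flip b) S.σ.val.ofConv ((ℛ k h).left i) ((ℛ k l).left j)
  exact congrArg (fun r => (a * r) ⊗ₜ[k] ((ℛ k h).right i * (ℛ k l).right j)) h2

end CrossedProduct

/-! ### Module algebras and smash products -/


/-- A left `L`-module algebra structure on the algebra `A`. -/
structure ModuleAlgebra (k L A : Type*) [Field k] [Ring L] [Bialgebra k L] [Ring A]
    [Algebra k A] where
  /-- the action, `act h a = h · a` -/
  act : L →ₗ[k] A →ₗ[k] A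
  /-- `1 · a = a` -/
  one_act : ∀ a : A, act 1 a = a
  /-- `(h l) · a = h · (l · a)` -/
  mul_act : ∀ (h l : L) (a : A), act (h * l) a = act h (act l a)
  /-- `h · 1 = ε(h) 1` -/
  act_one : ∀ h : L, act h 1 = algebraMap k A (counit h)
  /-- `h · (a b) = ∑ (h₁ · a) (h₂ · b)` -/
  act_mul : ∀ a b : A, toConv (act.flip (a * b)) = toConv (act.flip a) * toConv (act.flip b)

namespace ModuleAlgebra
variable {k L A : Type*} [Field k] [Ring L] [Bialgebra k L] [Ring A] [Algebra k A]

/-- The smash product `A # L` of a module algebra: the crossed product with trivial cocycle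
`σ(h, l) = ε(h) ε(l) 1`, so that `(a # h) (b # l) = ∑ a (h₁ · b) # h₂ l`. -/
def smash (N : ModuleAlgebra k L A) : CrossedSystem k L A where
  act := N.act
  one_act := N.one_act
  act_one := N.act_one
  act_mul := N.act_mul
  σ := 1
  σ_one_left h := by simp
  σ_one_right h := by simp
  twisted a := by
    simp only [Units.val_one, one_mul, inv_one, mul_one]
    congr 1
    ext h l
    simp [N.mul_act]
  cocycle := by
    congr 1
    · congr 1
      ext h l m
      simp [N.act_one, Algebra.algebraMap_eq_smul_one, smul_smul, mul_comm, mul_left_comm]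
    · congr 1
      ext h l m
      simp [Algebra.algebraMap_eq_smul_one, smul_smul, mul_comm, mul_left_comm]

theorem act_mul_apply (N : ModuleAlgebra k L A) (h : L) (a b : A) :
    N.act h (a * b) = ∑ i ∈ (ℛ k h).index,
      N.act ((ℛ k h).left i) a * N.act ((ℛ k h).right i) b :=
  N.smash.act_mul_apply h a b

theorem act_mul_of_apply {act : L →ₗ[k] A →ₗ[k] A} (a b : A)
    (H : ∀ h, act h (a * b) = ∑ i ∈ (ℛ k h).index,
      act ((ℛ k h).left i) a * act ((ℛ k h).right i) b) :
    toConv (act.flip (a * b)) = toConv (act.flip a) * toConv (act.flip b) := by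
  apply WithConv.ofConv_injective
  refine LinearMap.ext fun h => ?_
  rw [conv_apply]
  exact H h

end ModuleAlgebra

namespace CrossedSystem
variable {k H R L : Type*} [Field k] [Ring H] [Bialgebra k H] [Ring R] [Algebra k R]
  [Ring L] [Bialgebra k L]

/-- An `L`-module algebra structure on `H` with `Δ(l · h) = ∑ h₁ ⊗ (l · h₂)` makes `R #_σ H` an
`L`-module algebra by `l · (a # h) = a # (l · h)`. -/
def coefficientAction (S : CrossedSystem k H R) (N : ModuleAlgebra k L H)
    (hN : ∀ l, comul ∘ₗ N.act l = (N.act l).lTensor H ∘ₗ comul) :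
    ModuleAlgebra k L (CrossedProduct S) where
  act :=
    { toFun := fun l => (CrossedProduct.equiv S).toLinearMap ∘ₗ (N.act l).lTensor R ∘ₗ
        (CrossedProduct.equiv S).symm.toLinearMap
      map_add' := fun l m => by
        rw [map_add, LinearMap.lTensor_add, LinearMap.add_comp, LinearMap.comp_add]
      map_smul' := fun c l => by
        rw [map_smul, LinearMap.lTensor_smul, LinearMap.smul_comp, LinearMap.comp_smul]; rfl }
  one_act x := by
    have : N.act 1 = LinearMap.id := LinearMap.ext N.one_act
    simp [this]
  mul_act l m x := by
    have : N.act (l * m) = N.act l ∘ₗ N.act m := LinearMap.ext (N.mul_act l m)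
    simp [this, LinearMap.lTensor_comp]
  act_one l := by
    change (1 : R) ⊗ₜ[k] (N.act l 1) = (counit (R := k) l) • ((1 : R) ⊗ₜ[k] (1 : H))
    rw [N.act_one, Algebra.algebraMap_eq_smul_one, TensorProduct.tmul_smul]
  act_mul x y := by
    refine ModuleAlgebra.act_mul_of_apply x y fun l => ?_
    change (N.act l).lTensor R (S.mulLin x y) = ∑ i ∈ (ℛ k l).index,
      S.mulLin ((N.act ((ℛ k l).left i)).lTensor R x) ((N.act ((ℛ k l).right i)).lTensor R y)
    have key (x y : R ⊗[k] H) : (N.act l).lTensor R (S.mulLin x y) = ∑ i ∈ (ℛ k l).index,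
        S.mulLin ((N.act ((ℛ k l).left i)).lTensor R x)
          ((N.act ((ℛ k l).right i)).lTensor R y) := by
      induction x with
      | zero => simp
      | add x x' hx hx' => simp [hx, hx', Finset.sum_add_distrib]
      | tmul a h =>
      induction y with
      | zero => simp
      | add x x' hx hx' => simp only [map_add, hx, hx', Finset.sum_add_distrib]
      | tmul b g =>
      have h1 := S.mulLin_map LinearMap.id LinearMap.id (by simp) (by simp) a b h g
      simp only [LinearMap.id_apply] at h1
      simp only [LinearMap.lTensor_tmul]
      rw [h1]
      simp only [mulLin_map S _ _ (hN _) (hN _), map_sum, LinearMap.lTensor_tmul,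
        N.act_mul_apply, TensorProduct.tmul_sum]
      conv_rhs => rw [Finset.sum_comm]
      exact Finset.sum_congr rfl fun i _ => Finset.sum_comm
    exact key x y

end CrossedSystem

section hit
variable {k H : Type*} [Field k] [Ring H] [Bialgebra k H] [FiniteDimensional k H]

/-- The left action of `H*` on `H`, `f ⇀ h = ∑ h₁ f(h₂)`. -/
def hitLin : HDual k H →ₗ[k] H →ₗ[k] H where
  toFun f := (TensorProduct.rid k H).toLinearMap ∘ₗ (HDual.equiv k H f).lTensor H ∘ₗ comul
  map_add' f g := by
    rw [map_add, LinearMap.lTensor_add, LinearMap.add_comp, LinearMap.comp_add]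
  map_smul' c f := by
    rw [map_smul, LinearMap.lTensor_smul, LinearMap.smul_comp, LinearMap.comp_smul]; rfl

theorem hitLin_apply (f : HDual k H) (h : H) :
    hitLin f h = ∑ i ∈ (ℛ k h).index, f ((ℛ k h).right i) • (ℛ k h).left i := by
  simp only [hitLin, LinearMap.coe_mk, AddHom.coe_mk, LinearMap.comp_apply]
  rw [← (ℛ k h).eq]
  simp

theorem comul_hitLin (f : HDual k H) :
    comul ∘ₗ hitLin f = (hitLin f).lTensor H ∘ₗ comul := by
  have h1 (t : H ⊗[k] H) : comul (R := k) (TensorProduct.rid k H ((HDual.equiv k H f).lTensor H t)) =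
      (TensorProduct.rid k H).toLinearMap.lTensor H
        (((HDual.equiv k H f).lTensor H).lTensor H
          (TensorProduct.assoc k H H H (comul.rTensor H t))) := by
    induction t with
    | zero => simp
    | add x y hx hy => simp only [map_add, hx, hy]
    | tmul x y =>
      rw [LinearMap.rTensor_tmul, ← (ℛ k x).eq]
      simp [TensorProduct.sum_tmul, Finset.smul_sum, ← (ℛ k x).eq]
  ext h
  have h2 := h1 (comul h)
  rw [Coalgebra.coassoc_apply] at h2
  refine h2.trans ?_
  simp only [hitLin, LinearMap.coe_mk, AddHom.coe_mk, LinearMap.lTensor_comp, LinearMap.comp_apply]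

theorem hitLin_mul (f g : HDual k H) (h : H) : hitLin (f * g) h = hitLin f (hitLin g h) := by
  have h1 := LinearMap.congr_fun (comul_hitLin g) h
  simp only [LinearMap.comp_apply] at h1
  have h2 : hitLin f (hitLin g h) = TensorProduct.rid k H ((HDual.equiv k H f).lTensor H
    (comul (hitLin g h))) := rfl
  rw [h2, h1, hitLin_apply, ← (ℛ k h).eq]
  simp only [map_sum, LinearMap.lTensor_tmul, TensorProduct.rid_tmul]
  refine Finset.sum_congr rfl fun i _ => ?_
  congr 1
  rw [dual_mul_apply, hitLin_apply, ← (ℛ k ((ℛ k h).right i)).eq]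
  simp [mul_comm]

/-- `H` as a left `H*`-module algebra, `f ⇀ h = ∑ h₁ f(h₂)`. -/
def hit : ModuleAlgebra k (HDual k H) H where
  act := hitLin
  one_act h := by
    rw [hitLin_apply]
    have := congrArg (TensorProduct.rid k H) (sum_tmul_counit_eq (R := k) (ℛ k h))
    simp only [map_sum, TensorProduct.rid_tmul, one_smul] at this
    exact this
  mul_act := hitLin_mul
  act_one f := by
    simp [hitLin, Bialgebra.comul_one, Algebra.TensorProduct.one_def, dual_counit_apply,
      Algebra.algebraMap_eq_smul_one]
  act_mul a b := by
    refine ModuleAlgebra.act_mul_of_apply a b fun f => ?_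
    have h1 : hitLin f (a * b) = ∑ i ∈ (ℛ k a).index, ∑ j ∈ (ℛ k b).index,
        f ((ℛ k a).right i * (ℛ k b).right j) • ((ℛ k a).left i * (ℛ k b).left j) := by
      simp only [hitLin, LinearMap.coe_mk, AddHom.coe_mk, LinearMap.comp_apply]
      rw [Bialgebra.comul_mul, ← (ℛ k a).eq, ← (ℛ k b).eq]
      simp [Finset.sum_mul_sum]
    have h2 (x y : H) : f (x * y) = ∑ i ∈ (ℛ k f).index,
        (ℛ k f).left i x * (ℛ k f).right i y := by
      rw [← dualPair_comul_apply, ← (ℛ k f).eq, map_sum]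
      change HDual.equiv k (H ⊗[k] H) (∑ i ∈ _, _) _ = _
      rw [map_sum, LinearMap.sum_apply]
      simp [dualPair_tmul_tmul]
    rw [h1]
    simp only [hitLin_apply, h2, Finset.sum_smul, Finset.sum_mul_sum, smul_mul_smul_comm]
    conv_rhs => rw [Finset.sum_comm]
    exact Finset.sum_congr rfl fun i _ => Finset.sum_comm

/-- The left action of `H` on `H*`, `(h ⇀ f)(x) = f(x h)`, that is, `h ⇀ f = ∑ f₁ f₂(h)`. -/
def dualHitLin : H →ₗ[k] HDual k H →ₗ[k] HDual k H :=
  LinearMap.mk₂ k (fun h f => (HDual.equiv k H).symm (HDual.equiv k H f ∘ₗ LinearMap.mulRight k h))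
    (fun h l f => by apply dual_ext; ext x; simp [mul_add])
    (fun c h f => by apply dual_ext; ext x; simp)
    (fun h f g => by apply dual_ext; ext x; simp)
    (fun c h f => by apply dual_ext; ext x; simp)

theorem dualHitLin_apply (h : H) (f : HDual k H) (x : H) : dualHitLin h f x = f (x * h) := by
  simp [dualHitLin]

theorem comul_dualHitLin (h : H) :
    comul ∘ₗ dualHitLin h = (dualHitLin h).lTensor (HDual k H) ∘ₗ comul := by
  have h1 (t : HDual k H ⊗[k] HDual k H) (x y : H) :
      dualPair k H H ((dualHitLin h).lTensor (HDual k H) t) (x ⊗ₜ y) =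
        dualPair k H H t (x ⊗ₜ (y * h)) := by
    induction t with
    | zero => simp
    | add x y hx hy => simp [hx, hy]
    | tmul f g => simp [dualPair_tmul_tmul, dualHitLin_apply]
  refine LinearMap.ext fun f => ?_
  apply (dualPair k H H).injective
  apply dual_ext
  refine TensorProduct.ext' fun x y => ?_
  refine (dualPair_comul_apply _ x y).trans ?_
  refine Eq.trans ?_ (h1 (comul f) x y).symm
  rw [dualPair_comul_apply, dualHitLin_apply, mul_assoc]

/-- `H*` as a left `H`-module algebra, `(h ⇀ f)(x) = f(x h)`. -/
def dualHit : ModuleAlgebra k H (HDual k H) where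
  act := dualHitLin
  one_act f := by
    apply dual_ext; ext x
    simp [dualHitLin_apply]
  mul_act h l f := by
    apply dual_ext; ext x
    simp [dualHitLin_apply, mul_assoc]
  act_one h := by
    apply dual_ext; ext x
    simp [dualHitLin_apply, Algebra.algebraMap_eq_smul_one, mul_comm]
  act_mul f g := by
    refine ModuleAlgebra.act_mul_of_apply f g fun h => ?_
    apply dual_ext; ext x
    rw [map_sum, LinearMap.sum_apply]
    simp only [dual_equiv_apply, dualHitLin_apply, dual_mul_apply]
    rw [Bialgebra.comul_mul, ← (ℛ k x).eq, ← (ℛ k h).eq]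
    simp [Finset.sum_mul_sum, dualHitLin_apply]
    rw [Finset.sum_comm]

end hit

/-! ### Radicals -/

/-- The Jacobson radical `r_j(R)`, as a `k`-subspace of `R`. -/
def jacobsonRadical (k R : Type*) [Field k] [Ring R] [Algebra k R] : Submodule k R :=
  (Ring.jacobson R).restrictScalars k

namespace CrossedSystem
variable {k H R : Type*} [Field k] [Ring H] [Bialgebra k H] [Ring R] [Algebra k R]
variable (S : CrossedSystem k H R)

/-- `(I : H) = {x ∈ R | h · x ∈ I for all h ∈ H}` -/
def core (I : Submodule k R) : Submodule k R where
  carrier := {x | ∀ h : H, S.act h x ∈ I}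
  zero_mem' h := by simp
  add_mem' hx hy h := by simpa using I.add_mem (hx h) (hy h)
  smul_mem' c x hx h := by simpa using I.smul_mem c (hx h)

/-- `I #_σ H`, the subspace of `R #_σ H` spanned by the `a # h` with `a ∈ I` and `h ∈ H`. -/
def extension (I : Submodule k R) : Submodule k (CrossedProduct S) :=
  Submodule.span k {x | ∃ a ∈ I, ∃ h : H, x = CrossedProduct.mk S a h}

/-- `J ∩ R`, where `R` is identified with `R # 1`. -/
def contraction (J : Submodule k (CrossedProduct S)) : Submodule k R :=
  J.comap ((CrossedProduct.equiv S).toLinearMap ∘ₗ (TensorProduct.mk k R H).flip 1)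

theorem mem_contraction (J : Submodule k (CrossedProduct S)) (a : R) :
    a ∈ S.contraction J ↔ CrossedProduct.mk S a 1 ∈ J := Iff.rfl

/-- `r_{jH}(R) = (r_j(R) : H)` -/
def rjH : Submodule k R := S.core (jacobsonRadical k R)

/-- `r_{Hj}(R) = r_j(R #_σ H) ∩ R` -/
def rHj : Submodule k R := S.contraction (jacobsonRadical k (CrossedProduct S))

variable [FiniteDimensional k H]

/-- `A = R #_σ H` as a left `H*`-module algebra, `f · (a # h) = ∑ a # h₁ f(h₂)`. -/
def dualAction : ModuleAlgebra k (HDual k H) (CrossedProduct S) :=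
  S.coefficientAction hit comul_hitLin

/-- The smash product `A # H*` for `A = R #_σ H`. -/
def smashDual : CrossedSystem k (HDual k H) (CrossedProduct S) := S.dualAction.smash

/-- `A # H*` as a left `H`-module algebra, `h · (x # f) = x # (h ⇀ f)`, for `A = R #_σ H`. -/
def bidualAction : ModuleAlgebra k H (CrossedProduct S.smashDual) :=
  S.smashDual.coefficientAction dualHit comul_dualHitLin

end CrossedSystem

end
end HopfCrossed

namespace HopfCrossed
noncomputable section

open TensorProduct Coalgebra WithConv

/-! ### Convolution identities for the antipode -/

section Antipode

/-! The core is the second claim, `rHj_eq_rjH`, for an arbitrary crossed product with a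
finite-dimensional Hopf algebra; the other two follow by also applying it to `A # H*` and to `(A #
H*) # H`.

For `rjH ≤ rHj`, let `a` be in `rjH` and let `m` be a maximal left ideal of `A` that misses `a`.
Then `A = A a + m`, and moving `a` to the left past `1 # h` shows that `A a` lies in `r_j(R) (R ⊗
H)`. As `R ⊗ H` is finitely generated over `R`, Nakayama's lemma applied to its quotient by `m`
gives a contradiction.

For `rHj ≤ rjH`, write `γ(h) = 1 # h`. This map has a right convolution inverse `γ⁻¹`, whence `h · a
= ∑ γ(h₁) a γ⁻¹(h₂)` in `A` (`incl_act`). So the ideal `r_j(A)` contains `h · a` whenever it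
contains `a`. Moreover `r_j(A) ∩ R ⊆ r_j(R)`, because an element of `R` which is invertible in `A`
is invertible in `R`.

The inverse is `γ⁻¹(h) = ∑ σ⁻¹(S(h₂), h₃) # S(h₁)`. That `γ * γ⁻¹ = ε` reduces, through the cocycle
identity, to the value of a convolution product at the element `∑ h₁ ⊗ S(h₂) ⊗ h₃` of `H ⊗ H ⊗ H`,
where its factors cancel one by one (`cocycleConv_antipodeTriple`).

For the first and third claims, the same `γ⁻¹` recovers the coefficients of `x` in `A` from its
contractions `a # h ↦ ∑ a # h₁ φ(h₂)`. Hence, for a two-sided ideal `J`, `x` lies in `(J ∩ R) #_σ H`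
exactly when all contractions of `x` lie in `J` (`mem_extension_contraction_iff`). With `J = r_j(A)`
the contractions are the action of `H*`, so `rHj #_σ H` is `rjH` for `A # H*`, which equals `rHj`
there. One level up, the contractions of `A # H*` are the action of `H`, since `H** = H`, and the
argument repeats. -/

theorem convMul_ofConv_apply {k E T : Type*} [CommSemiring k] [AddCommMonoid E] [Module k E]
    [Coalgebra k E] [Semiring T] [Algebra k T] (f g : WithConv (E →ₗ[k] T)) (e : E) :
    (f * g).ofConv e =
      ∑ i ∈ (ℛ k e).index, f.ofConv ((ℛ k e).left i) * g.ofConv ((ℛ k e).right i) :=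
  Coalgebra.Repr.convMul_apply (ℛ k e) f g

variable {k H T : Type*} [CommSemiring k] [Semiring H] [HopfAlgebra k H] [Semiring T] [Algebra k T]

/-- The inclusion of the first factor into `A ⊗ B`. -/
abbrev tensorLeft (k A B : Type*) [CommSemiring k] [Semiring A] [Algebra k A] [Semiring B] [Algebra k B] :
    A →ₐ[k] A ⊗[k] B := Algebra.TensorProduct.includeLeft

/-- The inclusion of the second factor into `A ⊗ B`. -/
abbrev tensorRight (k A B : Type*) [CommSemiring k] [Semiring A] [Algebra k A] [Semiring B] [Algebra k B] :
    B →ₐ[k] A ⊗[k] B := Algebra.TensorProduct.includeRight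

theorem toConv_algHom_comp_mul {C A : Type*} [AddCommMonoid C] [Module k C] [Coalgebra k C]
    [Semiring A] [Algebra k A] (φ : A →ₐ[k] T) (f g : WithConv (C →ₗ[k] A)) :
    toConv (φ.toLinearMap ∘ₗ (f * g).ofConv) =
      toConv (φ.toLinearMap ∘ₗ f.ofConv) * toConv (φ.toLinearMap ∘ₗ g.ofConv) :=
  congrArg toConv (LinearMap.algHom_comp_convMul_distrib φ f g)

theorem toConv_algHom_comp_one {C A : Type*} [AddCommMonoid C] [Module k C] [Coalgebra k C]
    [Semiring A] [Algebra k A] (φ : A →ₐ[k] T) :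
    toConv (φ.toLinearMap ∘ₗ (1 : WithConv (C →ₗ[k] A)).ofConv) = 1 := by
  apply WithConv.ofConv_injective
  ext x
  change φ (algebraMap k A (counit x)) = algebraMap k T (counit x)
  simp

/-- Composition with an algebra map respects convolution, so this is the image under `f` of `S * id
= ε`. -/
theorem antipode_mul_algHom (f : H →ₐ[k] T) :
    toConv (f.toLinearMap ∘ₗ HopfAlgebra.antipode k) * toConv f.toLinearMap = 1 := by
  have := toConv_algHom_comp_mul f (toConv (HopfAlgebra.antipode k (A := H))) (toConv LinearMap.id)
  rw [LinearMap.antipode_mul_id, toConv_algHom_comp_one] at this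
  exact this.symm

/-- `Δ(x) = (x₁ ⊗ 1) (1 ⊗ x₂)` -/
theorem toConv_comul (C : Type*) [Semiring C] [Bialgebra k C] :
    (toConv comul : WithConv (C →ₗ[k] C ⊗[k] C)) =
      toConv (tensorLeft k C C).toLinearMap * toConv (tensorRight k C C).toLinearMap := by
  apply WithConv.ofConv_injective
  refine LinearMap.ext fun x => ?_
  rw [convMul_ofConv_apply]
  simp [← (ℛ k x).eq]

/-- `Δ(S(h)) = ∑ S(h₂) ⊗ S(h₁)` -/
theorem toConv_comul_antipode :
    (toConv (comul ∘ₗ HopfAlgebra.antipode k) : WithConv (H →ₗ[k] H ⊗[k] H)) =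
      toConv ((tensorRight k H H).toLinearMap ∘ₗ HopfAlgebra.antipode k) *
      toConv ((tensorLeft k H H).toLinearMap ∘ₗ HopfAlgebra.antipode k) := by
  -- Both sides are convolution inverses of `Δ` in `Hom(H, H ⊗ H)`: `Δ ∘ S` on the right, the
  -- product on the left.
  refine (left_inv_eq_right_inv (a := toConv (comul (R := k) (A := H))) ?_
    LinearMap.comul_right_inv).symm
  rw [toConv_comul, mul_assoc, ← mul_assoc (toConv ((tensorLeft k H H).toLinearMap ∘ₗ _)),
    antipode_mul_algHom, one_mul, antipode_mul_algHom]

theorem comul_antipode_apply (h : H) :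
    comul (R := k) (HopfAlgebra.antipode k h) =
      ∑ i ∈ (ℛ k h).index, HopfAlgebra.antipode k ((ℛ k h).right i) ⊗ₜ[k]
        HopfAlgebra.antipode k ((ℛ k h).left i) := by
  have := congrArg (fun f : WithConv (H →ₗ[k] H ⊗[k] H) => f.ofConv h)
    (toConv_comul_antipode (k := k) (H := H))
  refine this.trans ?_
  rw [convMul_ofConv_apply]
  simp

/-- The antipode reverses the coproduct, and commuting images allow the two factors to be
interchanged to match. -/
theorem toConv_comp_antipode_of_commute {f g : H →ₐ[k] T} (hfg : ∀ x y, Commute (f x) (g y)) :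
    toConv ((toConv f.toLinearMap * toConv g.toLinearMap).ofConv ∘ₗ HopfAlgebra.antipode k) =
      toConv (g.toLinearMap ∘ₗ HopfAlgebra.antipode k) *
      toConv (f.toLinearMap ∘ₗ HopfAlgebra.antipode k) := by
  apply WithConv.ofConv_injective
  refine LinearMap.ext fun x => ?_
  rw [convMul_ofConv_apply]
  change LinearMap.mul' k T (TensorProduct.map _ _ (comul (HopfAlgebra.antipode k x))) = _
  rw [comul_antipode_apply]
  simp [(hfg _ _).eq]

end Antipode

/-! ### Convolution products evaluated at `∑ a(h₁) b(S(h₂)) c(h₃)` -/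

section Triple
variable {k H C : Type*} [CommSemiring k] [Semiring H] [HopfAlgebra k H] [Semiring C] [Bialgebra k C]
variable (a b c : H →ₐc[k] C)

/-- A bialgebra map as an element of the convolution algebra. -/
def convHom (a : H →ₐc[k] C) : WithConv (H →ₗ[k] C) := toConv (a : H →ₐ[k] C).toLinearMap

/-- The composite of a bialgebra map and the antipode. -/
def convAntipode (a : H →ₐc[k] C) : WithConv (H →ₗ[k] C) :=
  toConv ((a : H →ₐ[k] C).toLinearMap ∘ₗ HopfAlgebra.antipode k)

/-- `h ↦ ∑ a(h₁) b(S(h₂)) c(h₃)` -/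
def twistTriple : WithConv (H →ₗ[k] C) := convHom a * (convAntipode b * convHom c)

theorem comul_convHom :
    toConv (comul ∘ₗ (convHom a).ofConv) =
      toConv ((tensorLeft k C C).toLinearMap ∘ₗ (convHom a).ofConv) *
      toConv ((tensorRight k C C).toLinearMap ∘ₗ (convHom a).ofConv) := by
  rw [← ofConv_toConv (comul (R := k) (A := C)), toConv_comul]
  exact congrArg toConv (LinearMap.convMul_comp_coalgHom_distrib _ _ a.toCoalgHom)

theorem comul_convAntipode :
    toConv (comul ∘ₗ (convAntipode b).ofConv) =
      toConv ((tensorRight k C C).toLinearMap ∘ₗ (convAntipode b).ofConv) *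
      toConv ((tensorLeft k C C).toLinearMap ∘ₗ (convAntipode b).ofConv) := by
  have h1 := toConv_comp_antipode_of_commute
    (f := (tensorLeft k C C).comp (b : H →ₐ[k] C)) (g := (tensorRight k C C).comp (b : H →ₐ[k] C))
    (fun x y => by simp [Commute, SemiconjBy])
  have h2 := congrArg (fun f : WithConv (H →ₗ[k] _) => toConv (f.ofConv ∘ₗ HopfAlgebra.antipode k))
    (comul_convHom b)
  exact h2.trans h1

/-- Because `Δ ∘ S` has its two legs reversed, the coproduct is `a(h₁) bS(h₄) c(h₅) ⊗ a(h₂) bS(h₃)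
c(h₆)`. The pairs `(h₂, h₃)` and `(h₄, h₅)` are adjacent, so associativity alone groups them. -/
theorem comul_twistTriple :
    toConv (comul ∘ₗ (twistTriple a b c).ofConv) =
      toConv ((tensorLeft k C C).toLinearMap ∘ₗ (convHom a).ofConv) *
      (toConv ((tensorRight k C C).toLinearMap ∘ₗ (convHom a * convAntipode b).ofConv) *
      (toConv ((tensorLeft k C C).toLinearMap ∘ₗ (convAntipode b * convHom c).ofConv) *
      toConv ((tensorRight k C C).toLinearMap ∘ₗ (convHom c).ofConv))) := by
  have h0 : comul (R := k) (A := C) = (Bialgebra.comulAlgHom k C).toLinearMap := rfl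
  have h1 := comul_convHom a
  have h2 := comul_convAntipode b
  have h3 := comul_convHom c
  rw [h0] at h1 h2 h3
  rw [twistTriple, h0]
  simp only [toConv_algHom_comp_mul, h1, h2, h3, mul_assoc]

variable {B : Type*} [Semiring B] [Algebra k B]

theorem conv_twistTriple (P Q : WithConv (C →ₗ[k] B)) (h : H) :
    (P * Q).ofConv ((twistTriple a b c).ofConv h) =
      ∑ i ∈ (ℛ k h).index, ∑ j ∈ (ℛ k ((ℛ k h).right i)).index,
      ∑ n ∈ (ℛ k ((ℛ k ((ℛ k h).right i)).right j)).index,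
        P.ofConv ((convHom a).ofConv ((ℛ k h).left i) *
          (convAntipode b * convHom c).ofConv ((ℛ k ((ℛ k ((ℛ k h).right i)).right j)).left n)) *
        Q.ofConv ((convHom a * convAntipode b).ofConv ((ℛ k ((ℛ k h).right i)).left j) *
          (convHom c).ofConv ((ℛ k ((ℛ k ((ℛ k h).right i)).right j)).right n)) := by
  have h1 : (P * Q).ofConv ((twistTriple a b c).ofConv h) =
    LinearMap.mul' k B (TensorProduct.map P.ofConv Q.ofConv
      ((toConv (comul ∘ₗ (twistTriple a b c).ofConv)).ofConv h)) := rfl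
  rw [h1, comul_twistTriple]
  generalize convHom a * convAntipode b = u
  generalize convAntipode b * convHom c = v
  simp only [convMul_ofConv_apply, Finset.mul_sum, map_sum]
  simp

variable {a b c}

/-- In the six-fold expansion `P` sees only the legs 1, 4 and 5. By `hP` it contributes their
counits, and what remains is the triple formed from the legs 2, 3 and 6, inside `Q`. -/
theorem conv_twistTriple_of_left {P : WithConv (C →ₗ[k] B)} (Q : WithConv (C →ₗ[k] B))
    (hP : ∀ x y, P.ofConv ((convHom a).ofConv x * (convAntipode b * convHom c).ofConv y) =
      algebraMap k B (counit x * counit y)) (h : H) :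
    (P * Q).ofConv ((twistTriple a b c).ofConv h) = Q.ofConv ((twistTriple a b c).ofConv h) := by
  refine (conv_twistTriple a b c P Q h).trans ?_
  -- The units are inserted where `P` has left counits, so that both sides become sums with the same
  -- iterated coproducts.
  have h2 : twistTriple a b c = 1 * ((convHom a * convAntipode b) * (1 * convHom c)) := by
    rw [one_mul, one_mul, twistTriple, mul_assoc]
  rw [h2]
  generalize convHom a * convAntipode b = u
  simp only [convMul_ofConv_apply u, convMul_ofConv_apply 1, Finset.mul_sum, map_sum, hP]
  refine Finset.sum_congr rfl fun i _ => Finset.sum_congr rfl fun j _ =>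
    Finset.sum_congr rfl fun n _ => ?_
  change _ = Q.ofConv (algebraMap k _ (counit _) * (_ * (algebraMap k _ (counit _) * _)))
  simp only [Algebra.algebraMap_eq_smul_one, smul_mul_assoc, one_mul, mul_smul_comm, map_smul,
    smul_smul, mul_comm]

/-- The mirror image: `Q` sees the legs 2, 3 and 6, and after it collapses `P` is left with the
triple on the legs 1, 4 and 5. -/
theorem conv_twistTriple_of_right (P : WithConv (C →ₗ[k] B)) {Q : WithConv (C →ₗ[k] B)}
    (hQ : ∀ x y, Q.ofConv ((convHom a * convAntipode b).ofConv x * (convHom c).ofConv y) =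
      algebraMap k B (counit x * counit y)) (h : H) :
    (P * Q).ofConv ((twistTriple a b c).ofConv h) = P.ofConv ((twistTriple a b c).ofConv h) := by
  refine (conv_twistTriple a b c P Q h).trans ?_
  generalize convHom a * convAntipode b = u at hQ ⊢
  have h2 : twistTriple a b c = convHom a * (1 * ((convAntipode b * convHom c) * 1)) := by
    rw [one_mul, mul_one, twistTriple]
  rw [h2]
  generalize convAntipode b * convHom c = v
  simp only [convMul_ofConv_apply (convHom a), convMul_ofConv_apply 1, convMul_ofConv_apply v, Finset.mul_sum, map_sum, hQ]
  refine Finset.sum_congr rfl fun i _ => Finset.sum_congr rfl fun j _ =>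
    Finset.sum_congr rfl fun n _ => ?_
  change _ = P.ofConv (_ * (algebraMap k _ (counit _) * (_ * (algebraMap k _ (counit _)))))
  simp only [Algebra.algebraMap_eq_smul_one, smul_mul_assoc, one_mul, mul_one, mul_smul_comm,
    map_smul, smul_smul, mul_comm]

end Triple

theorem mem_ringJacobson_iff {A : Type*} [Ring A] {x : A} :
    x ∈ Ring.jacobson A ↔ ∀ y, ∃ z, z * (y * x + 1) = 1 := by
  rw [← Ideal.jacobson_bot, Ideal.mem_jacobson_iff]
  refine forall_congr' fun y => exists_congr fun z => ?_
  rw [Ideal.mem_bot, sub_eq_zero, mul_add, mul_one, mul_assoc]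

/-- A left inverse `z` of `x + 1` satisfies `z = 1 - z x`, so `z` has a left inverse too, and this
must be `x + 1`. -/
theorem isUnit_add_one_of_mem_ringJacobson {A : Type*} [Ring A] {x : A}
    (hx : x ∈ Ring.jacobson A) : IsUnit (x + 1) := by
  obtain ⟨z, hz⟩ := mem_ringJacobson_iff.1 hx 1
  obtain ⟨w, hw⟩ := mem_ringJacobson_iff.1 hx (-z)
  rw [one_mul] at hz
  have h1 : -z * x + 1 = z := by
    rw [← hz]; noncomm_ring
  rw [h1] at hw
  have h2 : w = x + 1 := left_inv_eq_right_inv hw hz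
  exact ⟨⟨x + 1, z, h2 ▸ hw, hz⟩, rfl⟩

/-! ### `R` inside `R #_σ H`, and Nakayama's lemma -/

namespace CrossedSystem
variable {k H R : Type*} [Field k] [Ring H] [Bialgebra k H] [Ring R] [Algebra k R]
variable (S : CrossedSystem k H R)

theorem mk_one_mul_equiv (a : R) (t : R ⊗[k] H) :
    CrossedProduct.mk S a 1 * CrossedProduct.equiv S t = CrossedProduct.equiv S (a • t) := by
  change S.mulLin (a ⊗ₜ 1) t = a • t
  rw [mulLin_left, S.one_mulLin]
  induction t with
  | zero => simp
  | add x y hx hy => rw [mul_add, hx, hy, smul_add]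
  | tmul b h => simp [TensorProduct.smul_tmul']

/-- `R` as a subalgebra of `R #_σ H`. -/
def incl : R →ₐ[k] CrossedProduct S :=
  AlgHom.ofLinearMap ((CrossedProduct.equiv S).toLinearMap ∘ₗ (TensorProduct.mk k R H).flip 1) rfl
    (fun a b => by
      refine Eq.trans ?_ (mk_one_mul_equiv S a (b ⊗ₜ 1)).symm
      simp [TensorProduct.smul_tmul'])

theorem incl_apply (a : R) : S.incl a = CrossedProduct.mk S a 1 := rfl

theorem mem_contraction_iff (J : Submodule k (CrossedProduct S)) (a : R) :
    a ∈ S.contraction J ↔ S.incl a ∈ J := Iff.rfl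

theorem mem_rHj (a : R) : a ∈ S.rHj ↔ S.incl a ∈ Ring.jacobson (CrossedProduct S) := Iff.rfl

theorem mem_rjH (a : R) : a ∈ S.rjH ↔ ∀ h, S.act h a ∈ Ring.jacobson R := Iff.rfl

/-- `a # h ↦ ε(h) a` -/
def counitMap : CrossedProduct S →ₗ[k] R :=
  (TensorProduct.rid k R).toLinearMap ∘ₗ counit.lTensor R ∘ₗ (CrossedProduct.equiv S).symm.toLinearMap

/-- The retraction of `A` onto `R` need not be multiplicative; left `R`-linearity is enough to
transport one-sided inverses. -/
theorem counitMap_incl_mul (a : R) (x : CrossedProduct S) :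
    S.counitMap (S.incl a * x) = a * S.counitMap x := by
  obtain ⟨t, rfl⟩ := (CrossedProduct.equiv S).surjective x
  rw [incl_apply, mk_one_mul_equiv]
  simp only [counitMap, LinearMap.comp_apply, LinearEquiv.coe_coe, LinearEquiv.symm_apply_apply]
  induction t with
  | zero => simp
  | add x y hx hy => simp only [smul_add, map_add, mul_add, hx, hy]
  | tmul b h => simp [TensorProduct.smul_tmul']

theorem counitMap_one : S.counitMap 1 = 1 := by
  change TensorProduct.rid k R (counit.lTensor R ((1 : R) ⊗ₜ[k] (1 : H))) = 1
  simp

theorem counitMap_incl (a : R) : S.counitMap (S.incl a) = a := by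
  rw [← mul_one (S.incl a), counitMap_incl_mul, counitMap_one, mul_one]

theorem incl_injective : Function.Injective S.incl :=
  Function.LeftInverse.injective S.counitMap_incl

/-- Retracting `u v = 1` gives a right inverse of `u` inside `R`; by uniqueness of inverses in `A`
it is the two-sided inverse `v`. -/
theorem isUnit_of_isUnit_incl {u : R} (hu : IsUnit (S.incl u)) : IsUnit u := by
  obtain ⟨v, hv, hv'⟩ := isUnit_iff_exists.1 hu
  have h1 : u * S.counitMap v = 1 := by rw [← counitMap_incl_mul, hv, counitMap_one]
  have h2 : v = S.incl (S.counitMap v) :=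
    left_inv_eq_right_inv hv' (by rw [← map_mul, h1, map_one])
  refine isUnit_iff_exists.2 ⟨S.counitMap v, h1, S.incl_injective ?_⟩
  rw [map_mul, ← h2, hv', map_one]

/-- `r_{Hj}(R) ⊆ r_j(R)` -/
theorem mem_ringJacobson_of_mem_rHj {a : R} (ha : a ∈ S.rHj) : a ∈ Ring.jacobson R := by
  refine mem_ringJacobson_iff.2 fun y => ?_
  have h1 : S.incl (y * a + 1) = S.incl y * S.incl a + 1 := by simp
  have h2 := isUnit_add_one_of_mem_ringJacobson
    (Ideal.mul_mem_left _ (S.incl y) ((S.mem_rHj a).1 ha))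
  rw [← h1] at h2
  exact (S.isUnit_of_isUnit_incl h2).exists_left_inv

/-- `(1 # h) (a # 1) = ∑ h₁ · a # h₂` -/
theorem mk_one_mul_incl (h : H) (a : R) :
    CrossedProduct.mk S 1 h * S.incl a = ∑ i ∈ (ℛ k h).index,
      CrossedProduct.mk S (S.act ((ℛ k h).left i) a) ((ℛ k h).right i) := by
  refine (S.mulLin_one h a 1).trans ?_
  simp only [W_one_right, Algebra.TensorProduct.tmul_mul_tmul, mul_one, one_mul]
  rfl

theorem mk_eq_incl_mul (a : R) (h : H) :
    CrossedProduct.mk S a h = S.incl a * CrossedProduct.mk S 1 h := by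
  refine Eq.trans ?_ (mk_one_mul_equiv S a (1 ⊗ₜ h)).symm
  simp [TensorProduct.smul_tmul', CrossedProduct.mk]

/-- A left ideal of `R #_σ H` as a submodule of the left `R`-module `R ⊗ H`. -/
def leftIdealSubmodule (m : Ideal (CrossedProduct S)) : Submodule R (R ⊗[k] H) where
  carrier := {t | CrossedProduct.equiv S t ∈ m}
  zero_mem' := by simp
  add_mem' hx hy := by
    simp only [Set.mem_ofPred_eq, map_add] at *
    exact m.add_mem hx hy
  smul_mem' a t ht := by
    simp only [Set.mem_ofPred_eq] at *
    rw [← mk_one_mul_equiv]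
    exact m.mul_mem_left _ ht

theorem mem_leftIdealSubmodule {m : Ideal (CrossedProduct S)} {t : R ⊗[k] H} :
    t ∈ S.leftIdealSubmodule m ↔ CrossedProduct.equiv S t ∈ m := Iff.rfl

/-- For `x = b # h` the product is `∑ b (h₁ · a) # h₂`, and every `h₁ · a` lies in `r_j(R)`. -/
theorem equiv_symm_mul_incl_mem {a : R} (ha : a ∈ S.rjH) (x : CrossedProduct S) :
    (CrossedProduct.equiv S).symm (x * S.incl a) ∈
      Ring.jacobson R • (⊤ : Submodule R (R ⊗[k] H)) := by
  obtain ⟨t, rfl⟩ := (CrossedProduct.equiv S).surjective x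
  induction t with
  | zero => simp
  | add x y hx hy => simpa only [map_add, add_mul] using add_mem hx hy
  | tmul b h =>
    change (CrossedProduct.equiv S).symm (CrossedProduct.mk S b h * S.incl a) ∈ _
    rw [mk_eq_incl_mul, mul_assoc, mk_one_mul_incl, Finset.mul_sum, map_sum]
    refine sum_mem fun i _ => ?_
    have h1 : S.incl b * CrossedProduct.mk S (S.act ((ℛ k h).left i) a) ((ℛ k h).right i) =
        CrossedProduct.equiv S (b • S.act ((ℛ k h).left i) a •
          ((1 : R) ⊗ₜ[k] ((ℛ k h).right i))) := by
      rw [← mk_one_mul_equiv, incl_apply]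
      congr 2
      simp
    rw [h1, LinearEquiv.symm_apply_apply]
    exact Submodule.smul_mem _ _ (Submodule.smul_mem_smul (ha _) trivial)

/-- Nakayama's lemma over `R`, for the quotient of `R ⊗ H` by a maximal left ideal of `A`. Finite
dimension of `H` makes this quotient finitely generated. -/
theorem rjH_le_rHj [FiniteDimensional k H] : S.rjH ≤ S.rHj := by
  intro a ha
  rw [mem_rHj, Ring.jacobson_eq_sInf_isMaximal, Submodule.mem_sInf]
  intro m hm
  rw [Set.mem_ofPred_eq] at hm
  by_contra hmem
  -- Maximality gives `A a + m = A`, and `A a` is absorbed by `r_j(R) (R ⊗ H)`.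
  have hsup : Ring.jacobson R • (⊤ : Submodule R (R ⊗[k] H)) ⊔ S.leftIdealSubmodule m = ⊤ := by
    rw [eq_top_iff]
    intro t _
    have h1 : Ideal.span {S.incl a} ⊔ m = ⊤ := by
      rw [sup_comm]
      exact hm.1.2 _ (left_lt_sup.2 fun h => hmem (h (Ideal.subset_span rfl)))
    obtain ⟨y, hy, z, hz, hyz⟩ := Submodule.mem_sup.1
      (h1 ▸ Submodule.mem_top : CrossedProduct.equiv S t ∈ Ideal.span {S.incl a} ⊔ m)
    obtain ⟨x, rfl⟩ := Ideal.mem_span_singleton'.1 hy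
    rw [← (CrossedProduct.equiv S).symm_apply_apply t, ← hyz, map_add]
    refine Submodule.add_mem_sup (S.equiv_symm_mul_incl_mem ha x) ?_
    rwa [mem_leftIdealSubmodule, LinearEquiv.apply_symm_apply]
  have hne : S.leftIdealSubmodule m ≠ ⊤ := by
    intro h
    apply hm.ne_top
    rw [Ideal.eq_top_iff_one]
    have : (1 : R) ⊗ₜ[k] (1 : H) ∈ S.leftIdealSubmodule m := h ▸ trivial
    exact this
  have : Nontrivial ((R ⊗[k] H) ⧸ S.leftIdealSubmodule m) :=
    Submodule.Quotient.nontrivial_iff.2 hne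
  refine (Submodule.jacobson_smul_lt_top (R := R)
    (⊤ : Submodule R ((R ⊗[k] H) ⧸ S.leftIdealSubmodule m))).ne ?_
  -- Modulo `m` the second summand vanishes, so `r_j(R) M = M` for the nonzero quotient `M`.
  have h2 := congrArg (Submodule.map (S.leftIdealSubmodule m).mkQ) hsup
  rw [Submodule.map_sup, Submodule.map_smul'', Submodule.mkQ_map_self, sup_bot_eq,
    Submodule.map_top, Submodule.range_mkQ] at h2
  exact h2

end CrossedSystem

/-! ### The element `∑ h₁ ⊗ S(h₂) ⊗ h₃` -/

section Factors
variable (k H : Type*) [CommSemiring k] [Semiring H] [HopfAlgebra k H]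

/-- Bialgebra maps, with all instances derived from the bialgebra structures. -/
abbrev BialgebraHom (k H C : Type*) [CommSemiring k] [Semiring H] [Bialgebra k H] [Semiring C]
    [Bialgebra k C] : Type _ := H →ₐc[k] C

/-- `h ↦ h ⊗ 1 ⊗ 1` -/
def triFst : BialgebraHom k H (H ⊗[k] (H ⊗[k] H)) := by
  refine BialgHom.ofAlgHom (tensorLeft k H (H ⊗[k] H)) ?_ ?_
  · ext x; simp
  · ext x
    simp [Algebra.TensorProduct.one_def, ← (ℛ k x).eq, TensorProduct.sum_tmul]

/-- `h ↦ 1 ⊗ h ⊗ 1` -/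
def triSnd : BialgebraHom k H (H ⊗[k] (H ⊗[k] H)) := by
  refine BialgHom.ofAlgHom ((tensorRight k H (H ⊗[k] H)).comp (tensorLeft k H H)) ?_ ?_
  · ext x; simp
  · ext x
    simp [Algebra.TensorProduct.one_def, ← (ℛ k x).eq, TensorProduct.sum_tmul,
      TensorProduct.tmul_sum]

/-- `h ↦ 1 ⊗ 1 ⊗ h` -/
def triThd : BialgebraHom k H (H ⊗[k] (H ⊗[k] H)) := by
  refine BialgHom.ofAlgHom ((tensorRight k H (H ⊗[k] H)).comp (tensorRight k H H)) ?_ ?_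
  · ext x; simp
  · ext x
    simp [Algebra.TensorProduct.one_def, ← (ℛ k x).eq, TensorProduct.tmul_sum]

variable {k H}

theorem convHom_triFst_apply (h : H) :
    (convHom (triFst k H)).ofConv h = h ⊗ₜ[k] ((1 : H) ⊗ₜ[k] (1 : H)) := rfl

theorem convAntipode_triSnd_apply (h : H) :
    (convAntipode (triSnd k H)).ofConv h =
      (1 : H) ⊗ₜ[k] (HopfAlgebra.antipode k h ⊗ₜ[k] (1 : H)) := rfl

theorem convHom_triThd_apply (h : H) :
    (convHom (triThd k H)).ofConv h = (1 : H) ⊗ₜ[k] ((1 : H) ⊗ₜ[k] h) := rfl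

theorem convAntipode_mul_convHom_apply (h : H) :
    (convAntipode (triSnd k H) * convHom (triThd k H)).ofConv h =
      ∑ i ∈ (ℛ k h).index, (1 : H) ⊗ₜ[k] (HopfAlgebra.antipode k ((ℛ k h).left i) ⊗ₜ[k]
        (ℛ k h).right i) := by
  rw [convMul_ofConv_apply]
  simp only [convAntipode_triSnd_apply, convHom_triThd_apply,
    Algebra.TensorProduct.tmul_mul_tmul, one_mul, mul_one]

theorem convHom_mul_convAntipode_apply (h : H) :
    (convHom (triFst k H) * convAntipode (triSnd k H)).ofConv h =
      ∑ i ∈ (ℛ k h).index, (ℛ k h).left i ⊗ₜ[k]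
        (HopfAlgebra.antipode k ((ℛ k h).right i) ⊗ₜ[k] (1 : H)) := by
  rw [convMul_ofConv_apply]
  simp only [convAntipode_triSnd_apply, convHom_triFst_apply,
    Algebra.TensorProduct.tmul_mul_tmul, one_mul, mul_one]

/-- `h ↦ ∑ h₁ ⊗ S(h₂) ⊗ h₃` -/
def antipodeTriple : H →ₗ[k] H ⊗[k] (H ⊗[k] H) :=
  ((HopfAlgebra.antipode k).rTensor H ∘ₗ comul).lTensor H ∘ₗ comul

theorem antipodeTriple_apply (h : H) : antipodeTriple (k := k) h = ∑ i ∈ (ℛ k h).index,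
    (ℛ k h).left i ⊗ₜ[k] ((HopfAlgebra.antipode k).rTensor H (comul ((ℛ k h).right i))) := by
  rw [antipodeTriple, LinearMap.comp_apply, ← (ℛ k h).eq, map_sum]
  rfl

/-- This makes the collapsing lemmas for `twistTriple` available, with the three tensor-factor
inclusions as bialgebra maps. -/
theorem twistTriple_apply (h : H) :
    (twistTriple (triFst k H) (triSnd k H) (triThd k H)).ofConv h = antipodeTriple (k := k) h := by
  rw [antipodeTriple_apply, twistTriple, convMul_ofConv_apply]
  refine Finset.sum_congr rfl fun i _ => ?_
  rw [convAntipode_mul_convHom_apply, convHom_triFst_apply, Finset.mul_sum]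
  rw [← (ℛ k ((ℛ k h).right i)).eq]
  simp [TensorProduct.tmul_sum]

/-- The other bracketing, by associativity of convolution; it exposes `h₁ ⊗ S(h₂)` for cancellation.
-/
theorem antipodeTriple_eq_sum (h : H) : antipodeTriple (k := k) h = ∑ i ∈ (ℛ k h).index,
    ∑ j ∈ (ℛ k ((ℛ k h).left i)).index, (ℛ k ((ℛ k h).left i)).left j ⊗ₜ[k]
      (HopfAlgebra.antipode k ((ℛ k ((ℛ k h).left i)).right j) ⊗ₜ[k] (ℛ k h).right i) := by
  rw [← twistTriple_apply, twistTriple, ← mul_assoc, convMul_ofConv_apply]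
  simp only [convHom_mul_convAntipode_apply, convHom_triThd_apply, Finset.sum_mul,
    Algebra.TensorProduct.tmul_mul_tmul, one_mul, mul_one]

variable {B : Type*} [Semiring B] [Algebra k B]

theorem conv_antipodeTriple_of_left {P : WithConv (H ⊗[k] (H ⊗[k] H) →ₗ[k] B)}
    (Q : WithConv (H ⊗[k] (H ⊗[k] H) →ₗ[k] B))
    (hP : ∀ x y, ∑ i ∈ (ℛ k y).index, P.ofConv (x ⊗ₜ[k]
      (HopfAlgebra.antipode k ((ℛ k y).left i) ⊗ₜ[k] (ℛ k y).right i)) =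
        algebraMap k B (counit x * counit y)) (h : H) :
    (P * Q).ofConv (antipodeTriple (k := k) h) = Q.ofConv (antipodeTriple (k := k) h) := by
  rw [← twistTriple_apply]
  have h1 (x y : H) : P.ofConv ((convHom (triFst k H)).ofConv x *
      (convAntipode (triSnd k H) * convHom (triThd k H)).ofConv y) =
        algebraMap k B (counit x * counit y) := by
    rw [convAntipode_mul_convHom_apply, convHom_triFst_apply, Finset.mul_sum, map_sum, ← hP]
    simp only [Algebra.TensorProduct.tmul_mul_tmul, one_mul, mul_one]
  have h2 := conv_twistTriple_of_left (a := triFst k H) (b := triSnd k H) (c := triThd k H)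
    (P := P) Q h1 h
  exact h2

theorem conv_antipodeTriple_of_right (P : WithConv (H ⊗[k] (H ⊗[k] H) →ₗ[k] B))
    {Q : WithConv (H ⊗[k] (H ⊗[k] H) →ₗ[k] B)}
    (hQ : ∀ x y, ∑ i ∈ (ℛ k x).index, Q.ofConv ((ℛ k x).left i ⊗ₜ[k]
      (HopfAlgebra.antipode k ((ℛ k x).right i) ⊗ₜ[k] y)) =
        algebraMap k B (counit x * counit y)) (h : H) :
    (P * Q).ofConv (antipodeTriple (k := k) h) = P.ofConv (antipodeTriple (k := k) h) := by
  rw [← twistTriple_apply]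
  have h1 (x y : H) : Q.ofConv ((convHom (triFst k H) * convAntipode (triSnd k H)).ofConv x *
      (convHom (triThd k H)).ofConv y) =
        algebraMap k B (counit x * counit y) := by
    rw [convHom_mul_convAntipode_apply, convHom_triThd_apply, Finset.sum_mul, map_sum, ← hQ]
    simp only [Algebra.TensorProduct.tmul_mul_tmul, one_mul, mul_one]
  have h2 := conv_twistTriple_of_right (a := triFst k H) (b := triSnd k H) (c := triThd k H)
    (Q := Q) P h1 h
  exact h2

end Factors

/-! ### The convolution inverse of `h ↦ 1 # h` -/

namespace CrossedSystem
variable {k H R : Type*} [Field k] [Ring H] [HopfAlgebra k H] [Ring R] [Algebra k R]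
variable (S : CrossedSystem k H R)

theorem σ_inv_one_left (h : H) : S.σ⁻¹.val.ofConv (1 ⊗ₜ h) = algebraMap k R (counit h) := by
  have h1 : (S.σ.val * S.σ⁻¹.val).ofConv (1 ⊗ₜ h) = algebraMap k R (counit h) := by
    rw [Units.mul_inv]
    change algebraMap k R (counit ((1 : H) ⊗ₜ[k] h)) = _
    simp
  rw [conv_one_tmul] at h1
  rw [← h1]
  conv_lhs => rw [← sum_counit_smul (ℛ k h)]
  rw [TensorProduct.tmul_sum, map_sum]
  refine Finset.sum_congr rfl fun i _ => ?_
  refine Eq.trans ?_ (congrArg (· * _) (S.σ_one_left ((ℛ k h).left i)).symm)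
  simp [Algebra.algebraMap_eq_smul_one]

/-- `∑ (h₁ · σ⁻¹(l₁, m)) σ(h₂, l₂) = ∑ σ(h₁, l₁ m₁) σ⁻¹(h₂ l₂, m₂)` -/
theorem act_σ_inv :
    toConv (TensorProduct.lift S.act ∘ₗ S.σ⁻¹.val.ofConv.lTensor H) *
        toConv (S.σ.val.ofConv ∘ₗ prTwo.toLinearMap) =
      toConv (S.σ.val.ofConv ∘ₗ mulL.toLinearMap) *
        toConv (S.σ⁻¹.val.ofConv ∘ₗ (mulR.comp assoc').toLinearMap) := by
  have hone : toConv (S.σ.val.ofConv ∘ₗ (mulR.comp assoc').toLinearMap) *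
      toConv (S.σ⁻¹.val.ofConv ∘ₗ (mulR.comp assoc').toLinearMap) = 1 := by
    rw [← conv_comp, Units.mul_inv]
    apply WithConv.ofConv_injective
    refine LinearMap.ext fun x => ?_
    exact congrArg (algebraMap k R) (CoalgHomClass.counit_comp_apply (mulR.comp assoc') x)
  have hact : toConv (TensorProduct.lift S.act ∘ₗ S.σ⁻¹.val.ofConv.lTensor H) *
      toConv (TensorProduct.lift S.act ∘ₗ S.σ.val.ofConv.lTensor H) = 1 := by
    rw [← act_conv, Units.inv_mul]
    apply WithConv.ofConv_injective
    refine TensorProduct.ext' fun x y => ?_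
    change S.act x (algebraMap k R (counit y)) = algebraMap k R (counit (x ⊗ₜ[k] y))
    simp [Algebra.algebraMap_eq_smul_one, S.act_one, smul_smul]
  have hG : toConv ((TensorProduct.rid k R).toLinearMap ∘ₗ
        TensorProduct.map S.σ.val.ofConv counit ∘ₗ
          (TensorProduct.assoc k H H H).symm.toLinearMap) =
      toConv (S.σ.val.ofConv ∘ₗ prTwo.toLinearMap) := by
    congr 1; ext x y z; simp [prTwo]
  have hM : toConv (S.σ.val.ofConv ∘ₗ (LinearMap.mul' k H).rTensor H ∘ₗ
          (TensorProduct.assoc k H H H).symm.toLinearMap) =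
      toConv (S.σ.val.ofConv ∘ₗ (mulR.comp assoc').toLinearMap) := by
    rw [← mulR_eq, ← assoc'_eq]; rfl
  have hC := S.cocycle
  rw [hG, hM, ← mulL_eq] at hC
  -- The cocycle identity is solved by multiplying on the left by the inverse of `h · σ(l, m)` and
  -- on the right by that of `σ(h l, m)`.
  have h1 := congrArg (fun f => toConv (TensorProduct.lift S.act ∘ₗ S.σ⁻¹.val.ofConv.lTensor H) *
    f * toConv (S.σ⁻¹.val.ofConv ∘ₗ (mulR.comp assoc').toLinearMap)) hC
  simp only [← mul_assoc, hact, one_mul] at h1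
  rw [h1]
  simp only [mul_assoc, hone, mul_one]

/-- `l ⊗ m ↦ ∑ σ⁻¹(l₁, m) # l₂` -/
def cocycleInvMap : H ⊗[k] H →ₗ[k] R ⊗[k] H :=
  (inclL S.σ⁻¹.val.ofConv *
    inclR ((TensorProduct.rid k H).toLinearMap ∘ₗ counit.lTensor H)).ofConv

/-- `h ↦ ∑ σ⁻¹(S(h₂), h₃) # S(h₁)`, the convolution inverse of `h ↦ 1 # h`. -/
def sectionInv : H →ₗ[k] CrossedProduct S :=
  (CrossedProduct.equiv S).toLinearMap ∘ₗ S.cocycleInvMap ∘ₗ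
    (HopfAlgebra.antipode k).rTensor H ∘ₗ comul

/-- Multiplication by `1 # h` produces `h₁ · σ⁻¹` followed by a factor `σ`, precisely the
combination rewritten by `act_σ_inv`. In the result each factor can cancel against an antipode. -/
theorem mulLin_cocycleInvMap (h : H) (d : H ⊗[k] H) :
    S.mulLin (1 ⊗ₜ h) (S.cocycleInvMap d) =
      (inclL (S.σ.val.ofConv ∘ₗ mulL.toLinearMap) *
        (inclL (S.σ⁻¹.val.ofConv ∘ₗ (mulR.comp assoc').toLinearMap) *
          inclR (LinearMap.mul' k H ∘ₗ prTwo.toLinearMap))).ofConv (h ⊗ₜ d) := by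
  rw [cocycleInvMap, lemmaA, ← prTwo_eq, W, conv_comp, inclL_comp, inclR_comp, ← mul_assoc,
    ← mul_assoc, inclL_mul', inclL_mul', ← act_σ_inv]

theorem sum_σ_antipode_mul (x y : H) :
    ∑ i ∈ (ℛ k y).index, S.σ.val.ofConv
        (x ⊗ₜ[k] (HopfAlgebra.antipode k ((ℛ k y).left i) * (ℛ k y).right i)) =
      algebraMap k R (counit x * counit y) := by
  have h1 : S.σ.val.ofConv (x ⊗ₜ[k] 1) = algebraMap k R (counit x) := S.σ_one_right x
  rw [← map_sum, ← TensorProduct.tmul_sum, HopfAlgebra.sum_antipode_mul_eq_smul,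
    TensorProduct.tmul_smul, map_smul, h1, mul_comm, map_mul, Algebra.smul_def]

theorem sum_σ_inv_mul_antipode (x y : H) :
    ∑ i ∈ (ℛ k x).index, S.σ⁻¹.val.ofConv
        (((ℛ k x).left i * HopfAlgebra.antipode k ((ℛ k x).right i)) ⊗ₜ[k] y) =
      algebraMap k R (counit x * counit y) := by
  rw [← map_sum, ← TensorProduct.sum_tmul, HopfAlgebra.sum_mul_antipode_eq_smul,
    ← TensorProduct.smul_tmul', map_smul, σ_inv_one_left, map_mul, Algebra.smul_def]

/-- The factor `σ(x, S(y₁) y₂)` collapses from the left, then `x₁ S(x₂)` in the `H`-component from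
the right. What is left is `∑ σ⁻¹(h₁ S(h₂), h₃) = ε(h)`. -/
theorem cocycleConv_antipodeTriple (h : H) :
    (inclL (S.σ.val.ofConv ∘ₗ mulL.toLinearMap) *
      (inclL (S.σ⁻¹.val.ofConv ∘ₗ (mulR.comp assoc').toLinearMap) *
        inclR (LinearMap.mul' k H ∘ₗ prTwo.toLinearMap))).ofConv (antipodeTriple (k := k) h) =
      algebraMap k (R ⊗[k] H) (counit h) := by
  rw [conv_antipodeTriple_of_left, conv_antipodeTriple_of_right]
  · rw [antipodeTriple_eq_sum]
    have h1 (i : H × H) : ∑ j ∈ (ℛ k ((ℛ k h).left i)).index,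
        (inclL (S.σ⁻¹.val.ofConv ∘ₗ (mulR.comp assoc').toLinearMap) :
          WithConv (H ⊗[k] (H ⊗[k] H) →ₗ[k] R ⊗[k] H)).ofConv
        ((ℛ k ((ℛ k h).left i)).left j ⊗ₜ[k]
      (HopfAlgebra.antipode k ((ℛ k ((ℛ k h).left i)).right j) ⊗ₜ[k] (ℛ k h).right i)) =
        algebraMap k (R ⊗[k] H) (counit ((ℛ k h).left i) * counit ((ℛ k h).right i)) := by
      rw [← (tensorLeft k R H).commutes, ← sum_σ_inv_mul_antipode S, map_sum]
      rfl
    simp only [map_sum, h1]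
    rw [← map_sum]
    congr 1
    have h2 := congrArg (counit (R := k)) (sum_counit_smul (ℛ k h))
    simpa using h2
  · intro x y
    rw [← (tensorRight k R H).commutes, mul_comm, map_mul, ← Algebra.smul_def,
      ← HopfAlgebra.sum_mul_antipode_eq_algebraMap_counit (ℛ k x), Finset.smul_sum, map_sum]
    refine Finset.sum_congr rfl fun i _ => ?_
    simp [inclR, prTwo]
  · intro x y
    rw [← (tensorLeft k R H).commutes, ← sum_σ_antipode_mul S, map_sum]
    rfl

/-- `∑ (1 # h₁) γ⁻¹(h₂) = ε(h)` for `γ⁻¹ = sectionInv` -/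
theorem sum_mk_mul_sectionInv (h : H) :
    ∑ i ∈ (ℛ k h).index, CrossedProduct.mk S 1 ((ℛ k h).left i) *
      S.sectionInv ((ℛ k h).right i) = algebraMap k _ (counit h) := by
  refine Eq.trans ?_ (((S.cocycleConv_antipodeTriple h).trans
    (Algebra.algebraMap_eq_smul_one _)).trans
      (Algebra.algebraMap_eq_smul_one (A := CrossedProduct S) _).symm)
  rw [antipodeTriple_apply, map_sum]
  exact Finset.sum_congr rfl fun i _ => S.mulLin_cocycleInvMap _ _

end CrossedSystem

/-! ### Equality of the two radicals, and recovery of coefficients from contractions -/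

namespace CrossedSystem
variable {k H R : Type*} [Field k] [Ring H] [HopfAlgebra k H] [Ring R] [Algebra k R]
variable (S : CrossedSystem k H R)

/-- `h ↦ 1 # h` -/
def sectionMap : H →ₗ[k] CrossedProduct S :=
  (CrossedProduct.equiv S).toLinearMap ∘ₗ TensorProduct.mk k R H 1

theorem sectionMap_mul_sectionInv : toConv S.sectionMap * toConv S.sectionInv = 1 := by
  apply WithConv.ofConv_injective
  refine LinearMap.ext fun h => ?_
  rw [conv_apply]
  exact S.sum_mk_mul_sectionInv h

/-- `h · a = ∑ (1 # h₁) a γ⁻¹(h₂)` for `γ⁻¹ = sectionInv` -/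
theorem incl_act (h : H) (a : R) :
    S.incl (S.act h a) = ∑ i ∈ (ℛ k h).index,
      S.sectionMap ((ℛ k h).left i) * S.incl a * S.sectionInv ((ℛ k h).right i) := by
  -- The commutation rule `γ(h) a = ∑ (h₁ · a) γ(h₂)`; a right inverse of `γ` suffices to isolate `h
  -- · a`.
  have h1 : toConv (S.incl.toLinearMap ∘ₗ S.act.flip a) * toConv S.sectionMap =
      toConv (LinearMap.mulRight k (S.incl a) ∘ₗ S.sectionMap) := by
    apply WithConv.ofConv_injective
    refine LinearMap.ext fun h => ?_
    rw [conv_apply]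
    refine Eq.trans ?_ (S.mk_one_mul_incl h a).symm
    exact Finset.sum_congr rfl fun i _ => (S.mk_eq_incl_mul _ _).symm
  have h2 := congrArg (fun f => (f * toConv S.sectionInv).ofConv h) h1
  simp only [mul_assoc, sectionMap_mul_sectionInv, mul_one] at h2
  rw [conv_apply] at h2
  exact h2

/-- By `incl_act`, `h · a` lies in the two-sided ideal `r_j(A)` generated-closed under both
multiplications, hence in `r_j(A) ∩ R ⊆ r_j(R)`. -/
theorem rHj_le_rjH : S.rHj ≤ S.rjH := by
  intro a ha
  rw [mem_rjH]
  intro h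
  refine S.mem_ringJacobson_of_mem_rHj ((S.mem_rHj _).2 ?_)
  rw [incl_act]
  exact sum_mem fun i _ => Ideal.mul_mem_right _ _ (Ideal.mul_mem_left _ _ ((S.mem_rHj _).1 ha))

/-- For a crossed product with a finite-dimensional Hopf algebra, `r_{Hj}(R) = r_{jH}(R)`. -/
theorem rHj_eq_rjH [FiniteDimensional k H] : S.rHj = S.rjH :=
  le_antisymm S.rHj_le_rjH S.rjH_le_rHj

/-- `a # h ↦ ∑ a # h₁ φ(h₂)` -/
def contract (φ : H →ₗ[k] k) : CrossedProduct S →ₗ[k] CrossedProduct S :=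
  (CrossedProduct.equiv S).toLinearMap ∘ₗ
    ((TensorProduct.rid k H).toLinearMap ∘ₗ φ.lTensor H ∘ₗ comul).lTensor R ∘ₗ
    (CrossedProduct.equiv S).symm.toLinearMap

theorem contract_mk (φ : H →ₗ[k] k) (a : R) (h : H) :
    S.contract φ (CrossedProduct.mk S a h) = S.incl a *
      ∑ i ∈ (ℛ k h).index, φ ((ℛ k h).right i) • S.sectionMap ((ℛ k h).left i) := by
  have h1 : (TensorProduct.rid k H) (φ.lTensor H (comul h)) =
      ∑ i ∈ (ℛ k h).index, φ ((ℛ k h).right i) • (ℛ k h).left i := by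
    rw [← (ℛ k h).eq]
    simp
  simp only [← map_smul, ← map_sum, ← h1]
  exact S.mk_eq_incl_mul a _

/-- `a # h ↦ φ(h) a` -/
def coefficient (φ : H →ₗ[k] k) : CrossedProduct S →ₗ[k] R :=
  (TensorProduct.rid k R).toLinearMap ∘ₗ φ.lTensor R ∘ₗ (CrossedProduct.equiv S).symm.toLinearMap

theorem coefficient_mk (φ : H →ₗ[k] k) (a : R) (h : H) :
    S.coefficient φ (CrossedProduct.mk S a h) = φ h • a := by
  change TensorProduct.rid k R (φ.lTensor R (a ⊗ₜ[k] h)) = _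
  simp

theorem crossedProduct_induction {p : CrossedProduct S → Prop} (x : CrossedProduct S)
    (zero : p 0) (add : ∀ x y, p x → p y → p (x + y))
    (mk : ∀ a h, p (CrossedProduct.mk S a h)) : p x := by
  obtain ⟨t, rfl⟩ := (CrossedProduct.equiv S).surjective x
  induction t with
  | zero => simpa using zero
  | add x y hx hy => simpa only [map_add] using add _ _ hx hy
  | tmul a h => exact mk a h

/-- For `x = a # h` this is `φ(h) a = ∑ a γ(h₁) γ⁻¹(h₂) φ(h₃)`, with the last two legs expanded in
the basis. It places coefficients in any right ideal that contains the contractions. -/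
theorem incl_coefficient (φ : H →ₗ[k] k) {ι : Type*} [Fintype ι] (b : Module.Basis ι k H)
    (x : CrossedProduct S) :
    S.incl (S.coefficient φ x) = ∑ i, S.contract (b.coord i) x *
      (toConv S.sectionInv * toConv (Algebra.linearMap k (CrossedProduct S) ∘ₗ φ)).ofConv (b i) := by
  set δ := toConv S.sectionInv * toConv (Algebra.linearMap k (CrossedProduct S) ∘ₗ φ) with hδ
  have hδ' : toConv S.sectionMap * δ = toConv (Algebra.linearMap k (CrossedProduct S) ∘ₗ φ) := by
    rw [hδ, ← mul_assoc, sectionMap_mul_sectionInv, one_mul]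
  induction x using crossedProduct_induction with
  | zero => simp
  | add x y hx hy => simp only [map_add, add_mul, Finset.sum_add_distrib, hx, hy]
  | mk a h =>
    simp only [contract_mk, coefficient_mk, mul_assoc, ← Finset.mul_sum, Finset.sum_mul,
      smul_mul_assoc]
    rw [Finset.sum_comm]
    -- Summing over the dual basis reassembles `δ(h₂)` from the values `δ(bᵢ)`.
    have h1 (y : H) (z : CrossedProduct S) :
        ∑ i, b.coord i y • (z * δ.ofConv (b i)) = z * δ.ofConv y := by
      conv_rhs => rw [← b.sum_repr y]
      simp only [map_sum, map_smul, Finset.mul_sum, mul_smul_comm]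
      rfl
    simp only [h1]
    have h2 := congrArg (fun f => f.ofConv h) hδ'
    rw [conv_apply] at h2
    refine Eq.trans ?_ (congrArg (S.incl a * ·) h2.symm)
    simp [Algebra.algebraMap_eq_smul_one]

variable [FiniteDimensional k H]

/-- An element all of whose contractions lie in a two-sided ideal `J` belongs to
`(J ∩ R) #_σ H`, and conversely. -/
theorem mem_extension_contraction_iff (J : Ideal (CrossedProduct S)) [J.IsTwoSided]
    (x : CrossedProduct S) :
    x ∈ S.extension (S.contraction (J.restrictScalars k)) ↔ ∀ φ, S.contract φ x ∈ J := by
  constructor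
  · intro hx φ
    induction hx using Submodule.span_induction with
    | mem y hy =>
      obtain ⟨a, ha, h, rfl⟩ := hy
      rw [contract_mk]
      exact Ideal.mul_mem_right _ _ ha
    | zero => simp
    | add y z _ _ hy hz => simpa only [map_add] using add_mem hy hz
    | smul c y _ hy =>
      rw [map_smul]
      exact (J.restrictScalars k).smul_mem c hy
  · intro hx
    let b := Module.finBasis k H
    -- It is enough that each coefficient of `x` in a basis of `H` lies in `J ∩ R`.
    have h1 (y : CrossedProduct S) :
        y = ∑ i, CrossedProduct.mk S (S.coefficient (b.coord i) y) (b i) := by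
      induction y using crossedProduct_induction with
      | zero => simp [CrossedProduct.mk]
      | add x y hx hy =>
        conv_lhs => rw [hx, hy]
        simp only [map_add, CrossedProduct.mk, TensorProduct.add_tmul, Finset.sum_add_distrib]
      | mk a h =>
        simp only [coefficient_mk]
        simp only [CrossedProduct.mk, TensorProduct.smul_tmul]
        rw [← map_sum, ← TensorProduct.tmul_sum]
        congr 2
        exact (b.sum_repr h).symm
    rw [h1 x]
    refine sum_mem fun i _ => Submodule.subset_span ⟨_, ?_, _, rfl⟩
    rw [mem_contraction_iff, incl_coefficient S _ b]
    exact sum_mem fun j _ => Ideal.mul_mem_right _ _ (hx _)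

theorem mem_extension_rHj_iff (x : CrossedProduct S) :
    x ∈ S.extension S.rHj ↔ ∀ φ, S.contract φ x ∈ Ring.jacobson (CrossedProduct S) :=
  S.mem_extension_contraction_iff (Ring.jacobson (CrossedProduct S)) x

end CrossedSystem

/-! ### The Hopf algebra structure on `H*`, and `H** = H` -/

section DualAntipode
variable {k H : Type*} [Field k] [Ring H] [HopfAlgebra k H] [FiniteDimensional k H]

instance dualFiniteDimensional : FiniteDimensional k (HDual k H) :=
  Module.Finite.equiv (HDual.equiv k H).symm

/-- The antipode of the dual Hopf algebra, `f ↦ f ∘ S`. -/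
def dualAntipode : HDual k H →ₗ[k] HDual k H :=
  (HDual.equiv k H).symm.toLinearMap ∘ₗ (HopfAlgebra.antipode k (A := H)).lcomp k k ∘ₗ
    (HDual.equiv k H).toLinearMap

theorem dualAntipode_apply (f : HDual k H) (x : H) :
    dualAntipode f x = f (HopfAlgebra.antipode k x) := rfl

/-- Dualises the antipode axiom: at `t = Δ(f)` the right side is `f(∑ S(x₁) x₂)`. -/
theorem mul_dualAntipode_rTensor_apply (t : HDual k H ⊗[k] HDual k H) (x : H) :
    (LinearMap.mul' k (HDual k H) (dualAntipode.rTensor (HDual k H) t)) x =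
      dualPair k H H t ((HopfAlgebra.antipode k).rTensor H (comul x)) := by
  induction t with
  | zero => simp
  | add s t hs ht => simp only [map_add, dual_add_apply, hs, ht]
  | tmul f g =>
    rw [LinearMap.rTensor_tmul, LinearMap.mul'_apply, dual_mul_apply, ← (ℛ k x).eq]
    simp [dualPair_tmul_tmul, dualAntipode_apply]

theorem mul_dualAntipode_lTensor_apply (t : HDual k H ⊗[k] HDual k H) (x : H) :
    (LinearMap.mul' k (HDual k H) (dualAntipode.lTensor (HDual k H) t)) x =
      dualPair k H H t ((HopfAlgebra.antipode k).lTensor H (comul x)) := by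
  induction t with
  | zero => simp
  | add s t hs ht => simp only [map_add, dual_add_apply, hs, ht]
  | tmul f g =>
    rw [LinearMap.lTensor_tmul, LinearMap.mul'_apply, dual_mul_apply, ← (ℛ k x).eq]
    simp [dualPair_tmul_tmul, dualAntipode_apply]

theorem dualPair_comul_eq (f : HDual k H) (t : H ⊗[k] H) :
    dualPair k H H (comul f) t = f (LinearMap.mul' k H t) := by
  rw [dualPair_comul]; rfl

theorem dual_algebraMap_counit_apply (f : HDual k H) (x : H) :
    (algebraMap k (HDual k H) (counit f)) x = f (algebraMap k H (counit x)) := by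
  simp [Algebra.algebraMap_eq_smul_one, dual_counit_apply, mul_comm]

/-- The dual of a finite-dimensional Hopf algebra is a Hopf algebra. -/
instance dualHopfAlgebra : HopfAlgebra k (HDual k H) where
  antipode := dualAntipode
  mul_antipode_rTensor_comul := by
    refine LinearMap.ext fun f => dual_ext (LinearMap.ext fun x => ?_)
    refine (mul_dualAntipode_rTensor_apply (comul f) x).trans ?_
    rw [dualPair_comul_eq, HopfAlgebra.mul_antipode_rTensor_comul_apply]
    exact (dual_algebraMap_counit_apply f x).symm
  mul_antipode_lTensor_comul := by
    refine LinearMap.ext fun f => dual_ext (LinearMap.ext fun x => ?_)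
    refine (mul_dualAntipode_lTensor_apply (comul f) x).trans ?_
    rw [dualPair_comul_eq, HopfAlgebra.mul_antipode_lTensor_comul_apply]
    exact (dual_algebraMap_counit_apply f x).symm

/-- `h ⇀ f = ∑ f₁ f₂(h)` -/
theorem dualHitLin_eq (h : H) : dualHitLin h = (TensorProduct.rid k (HDual k H)).toLinearMap ∘ₗ
    (LinearMap.applyₗ h ∘ₗ (HDual.equiv k H).toLinearMap).lTensor (HDual k H) ∘ₗ comul := by
  have h1 (t : HDual k H ⊗[k] HDual k H) (x : H) : (TensorProduct.rid k (HDual k H)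
      ((LinearMap.applyₗ h ∘ₗ (HDual.equiv k H).toLinearMap).lTensor (HDual k H) t)) x =
        dualPair k H H t (x ⊗ₜ h) := by
    induction t with
    | zero => simp
    | add s t hs ht => simp only [map_add, dual_add_apply, hs, ht]
    | tmul f g => simp [dualPair_tmul_tmul, mul_comm]
  refine LinearMap.ext fun f => dual_ext (LinearMap.ext fun x => ?_)
  refine (dualHitLin_apply h f x).trans (Eq.trans ?_ (h1 (comul f) x).symm)
  rw [dualPair_comul_apply]

/-- Reflexivity of the finite-dimensional space `H`; contractions of `A # H*` are thus indexed by
`H`. -/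
theorem exists_eq_applyₗ (φ : HDual k H →ₗ[k] k) :
    ∃ h : H, φ = LinearMap.applyₗ h ∘ₗ (HDual.equiv k H).toLinearMap := by
  obtain ⟨h, hh⟩ := (Module.evalEquiv k H).surjective (φ ∘ₗ (HDual.equiv k H).symm.toLinearMap)
  refine ⟨h, LinearMap.ext fun f => ?_⟩
  exact (LinearMap.congr_fun hh (HDual.equiv k H f)).symm

end DualAntipode

/-! ### Contractions as the actions of `H*` and `H` -/

namespace CrossedSystem
variable {k H R : Type*} [Field k] [Ring H] [HopfAlgebra k H] [FiniteDimensional k H]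
  [Ring R] [Algebra k R] (S : CrossedSystem k H R)

/-- The action of `f` on `A` is by definition contraction with the form `f`, so both sides say that
all contractions lie in `r_j(A)`. -/
theorem extension_rHj_eq_smashDual_rjH : S.extension S.rHj = S.smashDual.rjH := by
  ext x
  rw [mem_extension_rHj_iff]
  exact ((HDual.equiv k H).toEquiv.forall_congr_left
    (p := fun f => S.dualAction.act f x ∈ Ring.jacobson (CrossedProduct S))).symm

/-- Since `h ⇀ f = ∑ f₁ f₂(h)`, the action of `h` is contraction with evaluation at `h`, and every
form on `H*` is such an evaluation. -/
theorem smashDual_extension_rHj_eq_bidual_rjH :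
    S.smashDual.extension S.smashDual.rHj = S.bidualAction.smash.rjH := by
  ext x
  rw [mem_extension_rHj_iff]
  have h1 (h : H) : S.bidualAction.act h =
      S.smashDual.contract (LinearMap.applyₗ h ∘ₗ (HDual.equiv k H).toLinearMap) := by
    refine Eq.trans (b := (CrossedProduct.equiv S.smashDual).toLinearMap ∘ₗ
      (dualHitLin h).lTensor _ ∘ₗ (CrossedProduct.equiv S.smashDual).symm.toLinearMap) rfl ?_
    rw [dualHitLin_eq]
    rfl
  constructor
  · intro hx h
    change S.bidualAction.act h x ∈ _
    rw [h1]
    exact hx _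
  · intro hx φ
    obtain ⟨h, rfl⟩ := exists_eq_applyₗ φ
    rw [← h1]
    exact hx h

end CrossedSystem
end
end HopfCrossed

theorem proposition2p9 {k H R : Type*} [Field k] [Ring H] [HopfAlgebra k H]
    [FiniteDimensional k H] [Ring R] [Algebra k R] (S : HopfCrossed.CrossedSystem k H R) :
    S.extension S.rjH = S.smashDual.rHj ∧
      S.rHj = S.rjH ∧
      S.bidualAction.smash.rHj = S.smashDual.extension (S.extension S.rHj) := by
  have h1 : S.extension S.rHj = S.smashDual.rHj :=
    S.extension_rHj_eq_smashDual_rjH.trans S.smashDual.rHj_eq_rjH.symm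
  refine ⟨S.rHj_eq_rjH ▸ h1, S.rHj_eq_rjH, ?_⟩
  rw [h1, S.smashDual_extension_rHj_eq_bidual_rjH, S.bidualAction.smash.rHj_eq_rjH]
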